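/- A \emph{Dewdney jeep} has a fuel tank of one unit, burns one unit of fuel per mile, and can in addition carry $B\ge 1$ cans of $C>0$ units of fuel each. Tank fuel is burnt only by the jeep itself; it cannot be transferred to other tanks or to cans. Can fuel may be put into the tank of any jeep at the same place. Let a desert $[0,d]$, $d>0$, with a fuel supply at its border $0$ and an oasis at $d$ be given, integers $n_1,n_2,m_1\ge 0$, $n=n_1+n_2$, and finitely many depots at positions $p\in(0,d]$, to be filled with $w(p)>0$ units of can fuel. \emph{Normal algorithms.} In a normal algorithm finitely many jeeps start empty at $0$ and perform finitely many actions (riding in $[0,d]$ with at most $B$ cans, moving can fuel to tanks or other cans at the same place, exchanging fuel with the supply at $0$), such that $n$ times a jeep rides from $0$ to $d$, $n_2$ times this is completed by a ride of the same jeep from $d$ back to $0$, at most $n_1+m_1$ jeeps do not end at $0$, and finally each depot $p$ holds at least $w(p)$ units of can fuel. Its cost is the net amount of fuel taken from the supply. \emph{The algorithm.} A convoy of $n_1$ single jeeps and $n_2$ double jeeps, ordered by age (single jeeps being the older ones), starts at $d$ and rides to $0$. Each jeep comes with one unit of tank fuel and $B$ full cans; can fuel is common to the convoy. Per mile, a single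 jeep consumes one unit and a double jeep two units of fuel, taken from its own tank if that is not empty, otherwise from the youngest older jeep with a nonempty tank, otherwise from the can fuel. Where a depot has to be filled, can fuel is used for it. Whenever there is not enough can fuel to fill the depot, or some jeep cannot ride farther due to lack of fuel, a new double jeep with one unit of tank fuel and $B$ full cans is created, and if there are then fewer than $n_1+m_1$ single jeeps, the oldest double jeep is replaced by a single jeep. If the convoy arrives at $0$ with $k$ jeeps and $f$ units of tank and can fuel in total, then the result is $k(1+BC)-f$. \emph{Extended backward convoy algorithms.} These start with the same convoy at $d$ and also ride to $0$ while filling the depots, but jeeps consume only their own tank fuel and can fuel. At any position one may add single or double jeeps (with one unit of tank fuel and $B$ full cans), replace a double jeep with at most one unit of tank fuel by a single jeep, put can fuel into tanks (up to one unit for a single and two units for a double jeep), and, at the price of $BC$ units of can fuel, merge a single and a double jeep with together $r\in[1,2]$ units of tank fuel to a single jeep with $r-1$ units, or two double jeeps with together $r\in[1,3]$ units to a double jeep with $r-1$ units. While riding there must be at most $n_1+m_1$ single jeeps, at least $n$ jeeps and at least $n_2$ double jeeps; if $m_1>0$, then moreover the $n_2$ initial double jeeps must remain distinct double jeeps all the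 way (possibly after merging with added double jeeps). The result is again $k(1+BC)-f$. \textbf{Theorem.} The algorithm reaches the desert border after finitely many actions, and it is optimal: its result is at most the cost of every normal algorithm, with any number of jeeps, and at most the result of every extended backward convoy algorithm. -/

import Mathlib

namespace Dewdney

/-! ### Normal algorithms

Jeeps and cans are moved one after another. Several jeeps that ride together and share a can are
covered, since a jeep may take fuel from any can at its position as often as it likes. -/

/-- A snapshot of `N` jeeps and `M` cans. `drawn` is the fuel taken so far from the supply at the
desert border (position `0`), net of the fuel that was given back to it. -/
structure Field (N M : ℕ) where
  jeepPos : Fin N → ℝ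
  tank : Fin N → ℝ
  canPos : Fin M → ℝ
  canFuel : Fin M → ℝ
  drawn : ℝ

/-- At the beginning everything stands empty at the desert border. -/
def Field.initial (N M : ℕ) : Field N M where
  jeepPos := fun _ => 0
  tank := fun _ => 0
  canPos := fun _ => 0
  canFuel := fun _ => 0
  drawn := 0

/-- One action of a normal algorithm. Tank fuel is only burnt by the jeep itself: it never goes to
another tank or into a can (outside the desert border). -/
inductive NormalStep (B : ℕ) (C d : ℝ) {N M : ℕ} : Field N M → Field N M → Prop
  /-- Jeep `j` rides to `y` on its tank fuel and takes along a set `S` of at most `B` cans. -/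
  | drive (σ : Field N M) (j : Fin N) (y : ℝ) (S : Finset (Fin M))
      (hy : y ∈ Set.Icc 0 d) (hS : S.card ≤ B) (hpos : ∀ k ∈ S, σ.canPos k = σ.jeepPos j)
      (hfuel : |y - σ.jeepPos j| ≤ σ.tank j) :
      NormalStep B C d σ
        { σ with
          jeepPos := Function.update σ.jeepPos j y
          tank := Function.update σ.tank j (σ.tank j - |y - σ.jeepPos j|)
          canPos := fun k => if k ∈ S then y else σ.canPos k }
  /-- Jeep `j` puts an amount `q` of fuel of can `k` into its tank, which has capacity `1`. -/
  | refuel (σ : Field N M) (j : Fin N) (k : Fin M) (q : ℝ)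
      (hpos : σ.canPos k = σ.jeepPos j) (hq : 0 ≤ q) (hk : q ≤ σ.canFuel k)
      (hj : σ.tank j + q ≤ 1) :
      NormalStep B C d σ
        { σ with
          tank := Function.update σ.tank j (σ.tank j + q)
          canFuel := Function.update σ.canFuel k (σ.canFuel k - q) }
  /-- An amount `q` of fuel is poured from can `k` into can `l`. -/
  | pour (σ : Field N M) (k l : Fin M) (q : ℝ) (hkl : k ≠ l)
      (hpos : σ.canPos k = σ.canPos l) (hq : 0 ≤ q) (hk : q ≤ σ.canFuel k)
      (hl : σ.canFuel l + q ≤ C) :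
      NormalStep B C d σ
        { σ with
          canFuel := Function.update (Function.update σ.canFuel k (σ.canFuel k - q)) l
            (σ.canFuel l + q) }
  /-- At the desert border a tank is brought to the level `t`. -/
  | tankAtBorder (σ : Field N M) (j : Fin N) (t : ℝ) (hpos : σ.jeepPos j = 0)
      (ht : t ∈ Set.Icc (0 : ℝ) 1) :
      NormalStep B C d σ
        { σ with
          tank := Function.update σ.tank j t
          drawn := σ.drawn + (t - σ.tank j) }
  /-- At the desert border a can is brought to the level `t`. -/
  | canAtBorder (σ : Field N M) (k : Fin M) (t : ℝ) (hpos : σ.canPos k = 0)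
      (ht : t ∈ Set.Icc 0 C) :
      NormalStep B C d σ
        { σ with
          canFuel := Function.update σ.canFuel k t
          drawn := σ.drawn + (t - σ.canFuel k) }

/-- The number of times that a path rides from `a` to `b` until time `T`. -/
noncomputable def crossings (path : ℕ → ℝ) (T : ℕ) (a b : ℝ) : ℕ :=
  Set.ncard {p : ℕ × ℕ | p.1 < p.2 ∧ p.2 ≤ T ∧ path p.1 = a ∧ path p.2 = b ∧
    ∀ t, p.1 < t → t < p.2 → path t ≠ a ∧ path t ≠ b}

/-- A normal algorithm with `N` jeeps (and any number `M` of cans): the oasis at `d` is reached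
from the desert border at least `n₁ + n₂` times and at least `n₂` times the jeep rides from the
oasis back to the border (all jeeps start at the border, so each ride back completes a round trip
of that jeep); at most `n₁ + m₁` jeeps do not end at the border; at each position `p` at least
`w p` units of can fuel remain. -/
structure NormalAlgorithm (B : ℕ) (C d : ℝ) (n₁ n₂ m₁ : ℕ) (w : ℝ →₀ ℝ) (N : ℕ) where
  M : ℕ
  T : ℕ
  state : ℕ → Field N M
  start : state 0 = Field.initial N M
  step : ∀ t < T, NormalStep B C d (state t) (state (t + 1))
  outward : n₁ + n₂ ≤ ∑ j, crossings (fun t => (state t).jeepPos j) T 0 d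
  back : n₂ ≤ ∑ j, crossings (fun t => (state t).jeepPos j) T d 0
  home : Set.ncard {j : Fin N | (state T).jeepPos j ≠ 0} ≤ n₁ + m₁
  depots : ∀ p : ℝ, w p ≠ 0 →
    w p ≤ ∑ k with (state T).canPos k = p, (state T).canFuel k

/-- The fuel that a normal algorithm uses from the desert border. -/
def NormalAlgorithm.fuel {B : ℕ} {C d : ℝ} {n₁ n₂ m₁ : ℕ} {w : ℝ →₀ ℝ} {N : ℕ}
    (A : NormalAlgorithm B C d n₁ n₂ m₁ w N) : ℝ :=
  (A.state A.T).drawn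

/-! ### The backward convoy algorithm -/

/-- A backward convoy at position `pos`. The jeeps are numbered `0, …, num - 1` in order of
creation (oldest first); those in `single` are single jeeps, the others are double jeeps; `cans` is
the (global) can fuel, and `todo p` is the fuel that a depot at `p` still has to get. -/
structure Convoy where
  pos : ℝ
  num : ℕ
  single : Finset ℕ
  tank : ℕ → ℝ
  cans : ℝ
  todo : ℝ →₀ ℝ

namespace Convoy

/-- Fuel consumption of jeep `i` per mile of the convoy. -/
def rate (c : Convoy) (i : ℕ) : ℝ := if i ∈ c.single then 1 else 2

/-- The least applicable fuel for jeep `i` is in the tank of jeep `j`: its own tank comes first,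
and next come the tanks of older jeeps, the youngest of these first. -/
def UsesTank (c : Convoy) (i j : ℕ) : Prop :=
  j ≤ i ∧ c.tank j ≠ 0 ∧ ∀ l, j < l → l ≤ i → c.tank l = 0

/-- Jeep `i` has only can fuel left to consume. -/
def UsesCans (c : Convoy) (i : ℕ) : Prop := ∀ l ≤ i, c.tank l = 0

open Classical in
/-- Total consumption per mile from the tank of jeep `j`. -/
noncomputable def tankRate (c : Convoy) (j : ℕ) : ℝ :=
  ∑ i ∈ Finset.range c.num with c.UsesTank i j, c.rate i

open Classical in
/-- Total consumption per mile of can fuel. -/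
noncomputable def canRate (c : Convoy) : ℝ :=
  ∑ i ∈ Finset.range c.num with c.UsesCans i, c.rate i

/-- Some jeep has no fuel to ride farther. -/
def Stuck (c : Convoy) : Prop := ∃ i < c.num, c.UsesCans i ∧ c.cans = 0

/-- The convoy with which the algorithm starts: `n₁` single and `n₂` double jeeps at `d`. -/
def initial (B : ℕ) (C d : ℝ) (n₁ n₂ : ℕ) (w : ℝ →₀ ℝ) : Convoy where
  pos := d
  num := n₁ + n₂
  single := Finset.range n₁
  tank := fun i => if i < n₁ + n₂ then 1 else 0
  cans := (n₁ + n₂ : ℕ) * (B * C)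
  todo := w

/-- Create a new double jeep with a full tank and `B` full cans; if there are now less than `s`
single jeeps, then replace the oldest double jeep (possibly the new one) by a single jeep. -/
noncomputable def addJeep (B : ℕ) (C : ℝ) (s : ℕ) (c : Convoy) : Convoy where
  pos := c.pos
  num := c.num + 1
  single :=
    if c.single.card < s then insert (sInf {i : ℕ | i < c.num + 1 ∧ i ∉ c.single}) c.single
    else c.single
  tank := Function.update c.tank c.num 1
  cans := c.cans + B * C
  todo := c.todo

/-- Make the depot at the current position. -/
noncomputable def fillDepot (c : Convoy) : Convoy :=
  { c with cans := c.cans - c.todo c.pos, todo := c.todo.erase c.pos }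

/-- Ride `h` miles towards the desert border. -/
noncomputable def ride (h : ℝ) (c : Convoy) : Convoy :=
  { c with
    pos := c.pos - h
    tank := fun j => c.tank j - h * c.tankRate j
    cans := c.cans - h * c.canRate }

/-- One action of the algorithm. During a single `ride` no jeep has to change to another source of
fuel and no unfilled depot is passed. -/
inductive Step (B : ℕ) (C : ℝ) (s : ℕ) : Convoy → Convoy → Prop
  | ride (c : Convoy) (h : ℝ) (hh : 0 < h) (hpos : h ≤ c.pos)
      (hdepot : ∀ p, c.pos - h < p → c.todo p = 0)
      (htank : ∀ j < c.num, h * c.tankRate j ≤ c.tank j) (hcans : h * c.canRate ≤ c.cans) :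
      Step B C s c (c.ride h)
  | fillDepot (c : Convoy) (hdepot : c.todo c.pos ≠ 0) (hcans : c.todo c.pos ≤ c.cans) :
      Step B C s c c.fillDepot
  | addForDepot (c : Convoy) (hcans : c.cans < c.todo c.pos) :
      Step B C s c (c.addJeep B C s)
  | addForRide (c : Convoy) (hpos : 0 < c.pos) (hstuck : c.Stuck) :
      Step B C s c (c.addJeep B C s)

end Convoy

/-- `r` is the result of the algorithm: the total load `1 + B * C` of all jeeps minus the fuel that
is left when the convoy arrives at the desert border. -/
def AlgorithmResult (B : ℕ) (C d : ℝ) (n₁ n₂ m₁ : ℕ) (w : ℝ →₀ ℝ) (r : ℝ) : Prop :=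
  ∃ c : Convoy,
    Relation.ReflTransGen (Convoy.Step B C (m₁ + n₁)) (Convoy.initial B C d n₁ n₂ w) c ∧
    c.pos = 0 ∧
    r = c.num * (1 + B * C) - (∑ i ∈ Finset.range c.num, c.tank i + c.cans)

/-! ### Extended backward convoy algorithms -/

/-- Single jeeps, double jeeps that have been added, and the double jeeps of the `n₂` round trips
to the oasis. -/
inductive Kind
  | single
  | double
  | round
  deriving DecidableEq

/-- Consumption per mile of the convoy; also the tank capacity of a jeep of this kind, since a
double jeep has a tank for the outward ride and one for the ride back. -/
def Kind.mult : Kind → ℝ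
  | .single => 1
  | .double => 2
  | .round => 2

/-- A jeep of an extended backward convoy, with its tank fuel. -/
structure ExtJeep where
  kind : Kind
  tank : ℝ

/-- An extended backward convoy. -/
structure ExtConvoy where
  pos : ℝ
  jeeps : List ExtJeep
  cans : ℝ
  todo : ℝ →₀ ℝ

/-- The total tank fuel of a list of jeeps. -/
def totalTank (l : List ExtJeep) : ℝ := (l.map ExtJeep.tank).sum

/-- The total consumption per mile of a list of jeeps. -/
def totalRate (l : List ExtJeep) : ℝ := (l.map fun a => a.kind.mult).sum

/-- The number of jeeps of a given kind. -/
def countKind (κ : Kind) (l : List ExtJeep) : ℕ := (l.map ExtJeep.kind).count κ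

/-- A convoy that can perform the task: at most `n₁ + m₁` single jeeps, at least `n₁ + n₂` jeeps,
and at least `n₂` double jeeps. If there are jeeps that may stay behind besides those of the `n₁`
one-way crossings, then moreover none of the `n₂` round trips has been broken off. -/
def Admissible (n₁ n₂ m₁ : ℕ) (l : List ExtJeep) : Prop :=
  countKind .single l ≤ n₁ + m₁ ∧
  n₁ + n₂ ≤ l.length ∧
  n₂ ≤ countKind .double l + countKind .round l ∧
  (m₁ ≠ 0 → n₂ ≤ countKind .round l)

/-- One action of an extended backward convoy algorithm. -/
inductive ExtStep (B : ℕ) (C : ℝ) (n₁ n₂ m₁ : ℕ) : ExtConvoy → ExtConvoy → Prop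
  /-- Ride `h` miles; each jeep consumes fuel of its own tank and can fuel. -/
  | ride (c : ExtConvoy) (h : ℝ) (l : List ExtJeep) (hh : 0 < h) (hpos : h ≤ c.pos)
      (hdepot : ∀ p, c.pos - h < p → c.todo p = 0)
      (hadm : Admissible n₁ n₂ m₁ c.jeeps)
      (hl : List.Forall₂ (fun a b => b.kind = a.kind ∧ 0 ≤ b.tank ∧ b.tank ≤ a.tank ∧
        a.tank - b.tank ≤ h * a.kind.mult) c.jeeps l)
      (hcans : h * totalRate c.jeeps - (totalTank c.jeeps - totalTank l) ≤ c.cans) :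
      ExtStep B C n₁ n₂ m₁ c
        { c with
          pos := c.pos - h
          jeeps := l
          cans := c.cans - (h * totalRate c.jeeps - (totalTank c.jeeps - totalTank l)) }
  | fillDepot (c : ExtConvoy) (hdepot : c.todo c.pos ≠ 0) (hcans : c.todo c.pos ≤ c.cans) :
      ExtStep B C n₁ n₂ m₁ c
        { c with cans := c.cans - c.todo c.pos, todo := c.todo.erase c.pos }
  /-- Add a single or a double jeep with a full tank and `B` full cans. -/
  | add (c : ExtConvoy) (κ : Kind) (hκ : κ ≠ .round) :
      ExtStep B C n₁ n₂ m₁ c { c with jeeps := ⟨κ, 1⟩ :: c.jeeps, cans := c.cans + B * C }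
  /-- Replace a double jeep by a single jeep. -/
  | replace (c : ExtConvoy) (a : ExtJeep) (l : List ExtJeep) (hc : c.jeeps = a :: l)
      (ha : a.tank ≤ 1) :
      ExtStep B C n₁ n₂ m₁ c { c with jeeps := ⟨.single, a.tank⟩ :: l }
  /-- Put can fuel in a tank. -/
  | refuel (c : ExtConvoy) (a : ExtJeep) (l : List ExtJeep) (q : ℝ) (hc : c.jeeps = a :: l)
      (hq : 0 ≤ q) (hcans : q ≤ c.cans) (ha : a.tank + q ≤ a.kind.mult) :
      ExtStep B C n₁ n₂ m₁ c
        { c with jeeps := ⟨a.kind, a.tank + q⟩ :: l, cans := c.cans - q }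
  /-- A single and a double jeep merge to a single jeep; `B` full cans have to be paid. -/
  | mergeSingle (c : ExtConvoy) (a b : ExtJeep) (l : List ExtJeep) (hc : c.jeeps = a :: b :: l)
      (ha : a.kind = .single) (hb : b.kind ≠ .single)
      (h1 : 1 ≤ a.tank + b.tank) (h2 : a.tank + b.tank ≤ 2) (hcans : B * C ≤ c.cans) :
      ExtStep B C n₁ n₂ m₁ c
        { c with jeeps := ⟨.single, a.tank + b.tank - 1⟩ :: l, cans := c.cans - B * C }
  /-- Two double jeeps merge to a double jeep; `B` full cans have to be paid. -/
  | mergeDouble (c : ExtConvoy) (a b : ExtJeep) (l : List ExtJeep) (hc : c.jeeps = a :: b :: l)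
      (ha : a.kind ≠ .single) (hb : b.kind ≠ .single)
      (h1 : 1 ≤ a.tank + b.tank) (h2 : a.tank + b.tank ≤ 3) (hcans : B * C ≤ c.cans) :
      ExtStep B C n₁ n₂ m₁ c
        { c with
          jeeps := ⟨if a.kind = .round then .round else b.kind, a.tank + b.tank - 1⟩ :: l
          cans := c.cans - B * C }
  /-- The order of the list is immaterial. -/
  | perm (c : ExtConvoy) (l : List ExtJeep) (hl : c.jeeps.Perm l) :
      ExtStep B C n₁ n₂ m₁ c { c with jeeps := l }

/-- The convoy at `d` with which an extended backward convoy algorithm starts. -/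
def ExtConvoy.initial (B : ℕ) (C d : ℝ) (n₁ n₂ : ℕ) (w : ℝ →₀ ℝ) : ExtConvoy where
  pos := d
  jeeps := List.replicate n₁ ⟨.single, 1⟩ ++ List.replicate n₂ ⟨.round, 1⟩
  cans := (n₁ + n₂ : ℕ) * (B * C)
  todo := w

/-- `r` is the result of some extended backward convoy algorithm. -/
def ExtendedResult (B : ℕ) (C d : ℝ) (n₁ n₂ m₁ : ℕ) (w : ℝ →₀ ℝ) (r : ℝ) : Prop :=
  ∃ c : ExtConvoy,
    Relation.ReflTransGen (ExtStep B C n₁ n₂ m₁) (ExtConvoy.initial B C d n₁ n₂ w) c ∧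
    c.pos = 0 ∧
    r = c.jeeps.length * (1 + B * C) - (totalTank c.jeeps + c.cans)

end Dewdney

namespace Dewdney

/-- Consumption per mile of the `m` oldest jeeps in a convoy of `k` jeeps of the algorithm. -/
def slope (n₁ n₂ m₁ m k : ℕ) : ℕ := 2 * min k m - min m (min (k - n₂) (n₁ + m₁))

/-- The integral from `x` to `d` of `f k`, where `k` is the size of a convoy that starts with `n`
jeeps and to which jeeps are added at the positions of a list, the last one first. -/
noncomputable def demand (d : ℝ) (n : ℕ) (f : ℕ → ℝ) : List ℝ → ℝ → ℝ
  | [], x => (d - x) * f n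
  | a :: L, x => demand d n f L (max a x) + max (a - x) 0 * f (n + L.length + 1)

/-- The fuel for depots beyond `x`. -/
noncomputable def weightBeyond (w : ℝ →₀ ℝ) (x : ℝ) : ℝ := ∑ p ∈ w.support with x < p, w p

/-- Below each position of the list, all jeeps that are available before the addition at that
position do not suffice, because of the consumption of the `m` oldest ones. -/
def Certified (B : ℕ) (C d : ℝ) (n₁ n₂ m₁ : ℕ) (w : ℝ →₀ ℝ) : List ℝ → Prop
  | [] => True
  | a :: L => Certified B C d n₁ n₂ m₁ w L ∧ a ≤ d ∧ ∃ m : ℕ, ∀ y, 0 ≤ y → y < a →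
      (n₁ + n₂ + L.length : ℕ) * (B * C) + m <
        demand d (n₁ + n₂) (fun k => slope n₁ n₂ m₁ m k) L y + weightBeyond w y

lemma demand_sub {d : ℝ} {n : ℕ} {f : ℕ → ℝ} {L : List ℝ} {x h : ℝ} (hL : ∀ a ∈ L, x ≤ a)
    (hh : 0 ≤ h) : demand d n f L (x - h) = demand d n f L x + h * f (n + L.length) := by
  cases L with
  | nil => simp [demand]; ring
  | cons a L =>
    have hx : x ≤ a := hL a (by simp)
    simp only [demand, max_eq_left hx, max_eq_left (sub_nonneg.2 hx), List.length_cons,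
      max_eq_left (show x - h ≤ a by linarith), max_eq_left (show 0 ≤ a - (x - h) by linarith),
      ← add_assoc]
    ring

lemma demand_sub_le {d : ℝ} {n : ℕ} {f : ℕ → ℝ} {L : List ℝ} {x h c : ℝ}
    (hf : ∀ k, n ≤ k → k ≤ n + L.length → f k ≤ c) (hh : 0 ≤ h) :
    demand d n f L (x - h) ≤ demand d n f L x + h * c := by
  induction L generalizing x h with
  | nil =>
    have := mul_le_mul_of_nonneg_left (hf n le_rfl (by simp)) hh
    simp only [demand]; linarith
  | cons a L ih =>
    have ih' : ∀ {x h : ℝ}, 0 ≤ h → demand d n f L (x - h) ≤ demand d n f L x + h * c :=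
      fun hh => ih (fun k h1 h2 => hf k h1 (by simp; omega)) hh
    have h1 := ih' (x := max a x) (h := max a x - max a (x - h))
      (sub_nonneg.2 (max_le_max le_rfl (by linarith)))
    rw [sub_sub_cancel] at h1
    have h2 : (max (a - (x - h)) 0 - max (a - x) 0) * f (n + L.length + 1) ≤
        (max (a - (x - h)) 0 - max (a - x) 0) * c :=
      mul_le_mul_of_nonneg_left (hf _ (by omega) (by rw [List.length_cons]; omega))
        (sub_nonneg.2 (max_le_max (by linarith) le_rfl))
    have h3 : max a x - max a (x - h) + (max (a - (x - h)) 0 - max (a - x) 0) = h := by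
      rcases le_total a x with h1 | h1 <;> rcases le_total a (x - h) with h2 | h2 <;>
      simp only [h1, h2, max_eq_left, max_eq_right, sub_nonneg, sub_nonpos] <;> ring
    have h4 : (max a x - max a (x - h)) * c + (max (a - (x - h)) 0 - max (a - x) 0) * c = h * c := by
      rw [← add_mul, h3]
    simp only [demand]
    linarith

lemma demand_congr {d : ℝ} {n : ℕ} {f g : ℕ → ℝ} {L : List ℝ}
    (hf : ∀ k, n ≤ k → k ≤ n + L.length → f k = g k) (x : ℝ) :
    demand d n f L x = demand d n g L x := by
  induction L generalizing x with
  | nil => simp [demand, hf n]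
  | cons a L ih =>
    simp only [demand]
    rw [ih (fun k h1 h2 => hf k h1 (by simp; omega)), hf _ (by omega) (by rw [List.length_cons]; omega)]

lemma slope_congr {n₁ n₂ m₁ m m' k : ℕ} (hm : k ≤ m) (hm' : k ≤ m') :
    slope n₁ n₂ m₁ m k = slope n₁ n₂ m₁ m' k := by
  unfold slope; omega

lemma demand_slope_congr {d : ℝ} {n₁ n₂ m₁ m m' : ℕ} {L : List ℝ}
    (hm : n₁ + n₂ + L.length ≤ m) (hm' : n₁ + n₂ + L.length ≤ m') (x : ℝ) :
    demand d (n₁ + n₂) (fun k => slope n₁ n₂ m₁ m k) L x =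
      demand d (n₁ + n₂) (fun k => slope n₁ n₂ m₁ m' k) L x :=
  demand_congr (fun k _ h => by rw [slope_congr (h.trans hm) (h.trans hm')]) x

/-! ### The algorithm -/

lemma sum_erase_eq (v : ℝ →₀ ℝ) (x : ℝ) :
    (v.sum fun _ q => q) = v x + (v.erase x).sum fun _ q => q := by
  by_cases h : x ∈ v.support
  · exact (Finsupp.add_sum_erase v x (fun _ q => q) h).symm
  · rw [Finsupp.notMem_support_iff.1 h, Finsupp.erase_of_notMem_support h, zero_add]

namespace Convoy

lemma tankRate_eq_zero {c : Convoy} {j : ℕ} (hj : c.tank j = 0) : c.tankRate j = 0 := by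
  classical
  unfold tankRate
  rw [Finset.filter_false_of_mem, Finset.sum_empty]
  exact fun i _ h => h.2.1 hj

lemma tankRate_eq_zero_of_le {c : Convoy} {j : ℕ} (hj : c.num ≤ j) : c.tankRate j = 0 := by
  classical
  unfold tankRate
  rw [Finset.filter_false_of_mem, Finset.sum_empty]
  intro i hi h
  have := Finset.mem_range.1 hi
  have := h.1
  omega

lemma rate_nonneg (c : Convoy) (i : ℕ) : 0 ≤ c.rate i := by
  unfold rate; split_ifs <;> norm_num

lemma tankRate_nonneg (c : Convoy) (j : ℕ) : 0 ≤ c.tankRate j :=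
  Finset.sum_nonneg fun i _ => c.rate_nonneg i

lemma canRate_nonneg (c : Convoy) : 0 ≤ c.canRate :=
  Finset.sum_nonneg fun i _ => c.rate_nonneg i

lemma canRate_le (c : Convoy) : c.canRate ≤ 2 * c.num := by
  classical
  unfold canRate
  calc _ ≤ ∑ i ∈ Finset.range c.num, c.rate i :=
        Finset.sum_le_sum_of_subset_of_nonneg (Finset.filter_subset _ _)
          (fun i _ _ => c.rate_nonneg i)
    _ ≤ ∑ i ∈ Finset.range c.num, 2 :=
        Finset.sum_le_sum (fun i _ => by unfold rate; split_ifs <;> norm_num)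
    _ = 2 * c.num := by simp [mul_comm]

lemma exists_usesTank {c : Convoy} {i : ℕ} (h : ¬ c.UsesCans i) : ∃ j, c.UsesTank i j := by
  unfold UsesCans at h
  push Not at h
  obtain ⟨l, hl, hl'⟩ := h
  classical
  have hP : ∃ j, j ≤ i ∧ c.tank j ≠ 0 := ⟨l, hl, hl'⟩
  have h1 := Nat.findGreatest_spec (P := fun j => c.tank j ≠ 0) hl hl'
  refine ⟨Nat.findGreatest (fun j => c.tank j ≠ 0) i, Nat.findGreatest_le i, h1, ?_⟩
  intro k hk hki
  by_contra h2
  exact Nat.findGreatest_is_greatest hk hki h2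

lemma UsesTank.unique {c : Convoy} {i j j' : ℕ} (h : c.UsesTank i j) (h' : c.UsesTank i j') :
    j = j' := by
  rcases lt_trichotomy j j' with hj | hj | hj
  · exact absurd (h.2.2 j' hj h'.1) h'.2.1
  · exact hj
  · exact absurd (h'.2.2 j hj h.1) h.2.1

/-- If the jeep `m` has tank fuel, then the cans and the tanks of the jeeps before it are used by
precisely these jeeps. -/
lemma canRate_add_sum_tankRate {c : Convoy} {m : ℕ} (hm : m ≤ c.num)
    (h : m = c.num ∨ c.tank m ≠ 0) :
    c.canRate + ∑ j ∈ Finset.range m, c.tankRate j = ∑ i ∈ Finset.range m, c.rate i := by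
  classical
  unfold canRate tankRate
  simp only [Finset.sum_filter]
  rw [Finset.sum_comm, ← Finset.sum_add_distrib]
  have key : ∀ i ∈ Finset.range c.num, ((if c.UsesCans i then c.rate i else 0) +
      ∑ j ∈ Finset.range m, if c.UsesTank i j then c.rate i else 0) =
      if i < m then c.rate i else 0 := by
    intro i hi
    rw [Finset.mem_range] at hi
    by_cases him : i < m
    · rw [if_pos him]
      by_cases hu : c.UsesCans i
      · rw [if_pos hu, Finset.sum_eq_zero, add_zero]
        intro j _
        rw [if_neg]
        exact fun hj => hj.2.1 (hu j hj.1)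
      · obtain ⟨j, hj⟩ := exists_usesTank hu
        rw [if_neg hu, zero_add, Finset.sum_eq_single j]
        · rw [if_pos hj]
        · intro k _ hk
          rw [if_neg]
          exact fun h' => hk (h'.unique hj)
        · intro hj'
          have := hj.1
          simp at hj'; omega
    · have htm : c.tank m ≠ 0 := by
        rcases h with h | h
        · omega
        · exact h
      rw [if_neg him, if_neg (fun hu => htm (hu m (by omega))), zero_add, Finset.sum_eq_zero]
      intro j hj
      rw [Finset.mem_range] at hj
      rw [if_neg]
      exact fun hu => htm (hu.2.2 m hj (by omega))
  rw [Finset.sum_congr rfl key, ← Finset.sum_filter]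
  congr 1
  ext i; simp; omega

lemma sum_rate_range {c : Convoy} {s m : ℕ} (hs : c.single = Finset.range s) :
    ∑ i ∈ Finset.range m, c.rate i = 2 * m - (min m s : ℕ) := by
  induction m with
  | zero => simp
  | succ m ih =>
    rw [Finset.sum_range_succ, ih]
    unfold rate
    simp only [hs, Finset.mem_range]
    split_ifs with h
    · rw [min_eq_left (by omega), min_eq_left (by omega)]; push_cast; ring
    · rw [min_eq_right (by omega), min_eq_right (by omega)]; push_cast; ring

/-- What is known of a convoy of the algorithm to which jeeps have been added at the positions
of `L`. -/
structure Balanced (B : ℕ) (C d : ℝ) (n₁ n₂ m₁ : ℕ) (w : ℝ →₀ ℝ) (c : Convoy) (L : List ℝ) :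
    Prop where
  num_eq : c.num = n₁ + n₂ + L.length
  single_eq : c.single = Finset.range (min (c.num - n₂) (n₁ + m₁))
  pos_le : c.pos ≤ d
  pos_le_mem : ∀ a ∈ L, c.pos ≤ a
  tank_nonneg : ∀ j, 0 ≤ c.tank j
  tank_eq_zero : ∀ j, c.num ≤ j → c.tank j = 0
  cans_nonneg : 0 ≤ c.cans
  todo_eq : ∀ p, c.todo p = w p ∨ c.todo p = 0 ∧ c.pos ≤ p
  certified : Certified B C d n₁ n₂ m₁ w L
  balance : ∀ m ≤ c.num, (m = c.num ∨ c.tank m ≠ 0) →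
    demand d (n₁ + n₂) (fun k => slope n₁ n₂ m₁ m k) L c.pos +
      ((w.sum fun _ q => q) - c.todo.sum fun _ q => q) + c.cans +
      ∑ j ∈ Finset.range m, (c.tank j - 1) = c.num * (B * C)

lemma balanced_initial {B : ℕ} {C d : ℝ} {n₁ n₂ m₁ : ℕ} {w : ℝ →₀ ℝ} (hC : 0 < C) :
    Balanced B C d n₁ n₂ m₁ w (initial B C d n₁ n₂ w) [] where
  num_eq := by simp [initial]
  single_eq := by simp [initial]
  pos_le := le_rfl
  pos_le_mem := by simp
  tank_nonneg j := by simp only [initial]; split_ifs <;> norm_num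
  tank_eq_zero j hj := by simp only [initial] at *; rw [if_neg (by omega)]
  cans_nonneg := by simp only [initial]; positivity
  todo_eq p := Or.inl rfl
  certified := trivial
  balance m hm _ := by
    simp only [initial] at *
    rw [Finset.sum_eq_zero]
    · simp [demand]
    · intro j hj
      rw [Finset.mem_range] at hj
      rw [if_pos (by omega), sub_self]

lemma Balanced.ride {B : ℕ} {C d : ℝ} {n₁ n₂ m₁ : ℕ} {w : ℝ →₀ ℝ} {c : Convoy} {L : List ℝ}
    (hc : c.Balanced B C d n₁ n₂ m₁ w L) {h : ℝ} (hh : 0 < h)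
    (htank : ∀ j < c.num, h * c.tankRate j ≤ c.tank j) (hcans : h * c.canRate ≤ c.cans) :
    (c.ride h).Balanced B C d n₁ n₂ m₁ w L where
  num_eq := hc.num_eq
  single_eq := hc.single_eq
  pos_le := by have := hc.pos_le; simp only [Convoy.ride]; linarith
  pos_le_mem a ha := by have := hc.pos_le_mem a ha; simp only [Convoy.ride]; linarith
  tank_nonneg j := by
    simp only [Convoy.ride]
    by_cases hj : j < c.num
    · linarith [htank j hj]
    · rw [tankRate_eq_zero_of_le (by omega), mul_zero, sub_zero]; exact hc.tank_nonneg j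
  tank_eq_zero j hj := by
    simp only [Convoy.ride] at *
    rw [tankRate_eq_zero_of_le hj, hc.tank_eq_zero j hj]; simp
  cans_nonneg := by simp only [Convoy.ride]; linarith
  todo_eq p := by
    rcases hc.todo_eq p with h1 | ⟨h1, h2⟩
    · exact Or.inl h1
    · refine Or.inr ⟨h1, ?_⟩
      simp only [Convoy.ride]; linarith
  certified := hc.certified
  balance m hm hm' := by
    simp only [Convoy.ride] at hm hm' ⊢
    have h1 : m = c.num ∨ c.tank m ≠ 0 := by
      refine hm'.imp_right fun h h0 => h ?_
      rw [tankRate_eq_zero h0, h0]; simp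
    have h2 := hc.balance m hm h1
    have h3 := canRate_add_sum_tankRate hm h1
    rw [sum_rate_range hc.single_eq] at h3
    have h4 : ((slope n₁ n₂ m₁ m (n₁ + n₂ + L.length) : ℕ) : ℝ) =
        2 * m - (min m (min (c.num - n₂) (n₁ + m₁)) : ℕ) := by
      rw [← hc.num_eq, slope, Nat.cast_sub (by omega), min_eq_right hm]; push_cast; ring
    have h5 : ∑ j ∈ Finset.range m, (c.tank j - h * c.tankRate j - 1) =
        ∑ j ∈ Finset.range m, (c.tank j - 1) - h * ∑ j ∈ Finset.range m, c.tankRate j := by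
      rw [Finset.mul_sum, ← Finset.sum_sub_distrib]
      exact Finset.sum_congr rfl fun j _ => by ring
    rw [demand_sub hc.pos_le_mem hh.le, h5, h4, ← h3]
    linarith

lemma Balanced.fillDepot {B : ℕ} {C d : ℝ} {n₁ n₂ m₁ : ℕ} {w : ℝ →₀ ℝ} {c : Convoy} {L : List ℝ}
    (hc : c.Balanced B C d n₁ n₂ m₁ w L) (hcans : c.todo c.pos ≤ c.cans) :
    c.fillDepot.Balanced B C d n₁ n₂ m₁ w L where
  num_eq := hc.num_eq
  single_eq := hc.single_eq
  pos_le := hc.pos_le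
  pos_le_mem := hc.pos_le_mem
  tank_nonneg := hc.tank_nonneg
  tank_eq_zero := hc.tank_eq_zero
  cans_nonneg := by simp only [Convoy.fillDepot]; linarith
  todo_eq p := by
    simp only [Convoy.fillDepot]
    by_cases hp : p = c.pos
    · subst hp; right; simp
    · rw [Finsupp.erase_ne hp]; exact hc.todo_eq p
  certified := hc.certified
  balance m hm hm' := by
    have h1 := hc.balance m hm hm'
    simp only [Convoy.fillDepot]
    rw [sum_erase_eq c.todo c.pos] at h1
    linarith

lemma weightBeyond_eq_sum (w : ℝ →₀ ℝ) (y : ℝ) :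
    weightBeyond w y = w.sum fun p q => if y < p then q else 0 := by
  rw [weightBeyond, Finset.sum_filter, Finsupp.sum]

/-- The depots beyond `y` comprise those that have been filled and the one at the current
position. -/
lemma Balanced.le_weightBeyond {B : ℕ} {C d : ℝ} {n₁ n₂ m₁ : ℕ} {w : ℝ →₀ ℝ} {c : Convoy}
    {L : List ℝ} (hc : c.Balanced B C d n₁ n₂ m₁ w L) (hw : ∀ p, 0 ≤ w p) {y : ℝ}
    (hy : y < c.pos) :
    ((w.sum fun _ q => q) - c.todo.sum fun _ q => q) + c.todo c.pos ≤ weightBeyond w y := by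
  have hsub : c.todo.support ⊆ w.support := by
    intro p hp
    rw [Finsupp.mem_support_iff] at *
    rcases hc.todo_eq p with h | h
    · rwa [← h]
    · exact absurd h.1 hp
  rw [weightBeyond_eq_sum, Finsupp.sum_of_support_subset c.todo hsub _ (by simp)]
  unfold Finsupp.sum
  have h1 : c.todo c.pos = ∑ p ∈ w.support, if p = c.pos then c.todo p else 0 := by
    rw [Finset.sum_ite_eq']
    split_ifs with h
    · rfl
    · exact Finsupp.notMem_support_iff.1 fun h' => h (hsub h')
  rw [h1, ← Finset.sum_sub_distrib, ← Finset.sum_add_distrib]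
  refine Finset.sum_le_sum fun p _ => ?_
  have := hw p
  by_cases hp : p = c.pos
  · subst hp; simp [hy]
  · rw [if_neg hp]
    dsimp only
    rcases hc.todo_eq p with h | h
    · rw [h]; split_ifs <;> linarith
    · rw [if_pos (hy.trans_le h.2), h.1]; linarith

lemma addJeep_single {B : ℕ} {C : ℝ} {n₁ n₂ m₁ : ℕ} {c : Convoy}
    (hn : n₁ + n₂ ≤ c.num)
    (hs : c.single = Finset.range (min (c.num - n₂) (n₁ + m₁))) :
    (c.addJeep B C (m₁ + n₁)).single =
      Finset.range (min (c.num + 1 - n₂) (n₁ + m₁)) := by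
  simp only [addJeep]
  have h1 : sInf {i : ℕ | i < c.num + 1 ∧ i ∉ c.single} = min (c.num - n₂) (n₁ + m₁) := by
    apply le_antisymm
    · apply Nat.sInf_le
      rw [hs]; simp only [Set.mem_ofPred_eq, Finset.mem_range]; omega
    · refine le_csInf ⟨c.num, ?_⟩ ?_
      · rw [hs]; simp only [Set.mem_ofPred_eq, Finset.mem_range]; omega
      · intro i hi
        rw [hs] at hi; simp only [Set.mem_ofPred_eq, Finset.mem_range] at hi; omega
  rw [h1, hs, Finset.card_range]
  split_ifs with h
  · rw [← Finset.range_add_one]; congr 1; omega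
  · congr 1; omega

lemma Balanced.addJeep {B : ℕ} {C d : ℝ} {n₁ n₂ m₁ : ℕ} {w : ℝ →₀ ℝ} {c : Convoy} {L : List ℝ}
    (hC : 0 < C) (hw : ∀ p, 0 ≤ w p)
    (hc : c.Balanced B C d n₁ n₂ m₁ w L) (h : c.cans < c.todo c.pos ∨ c.Stuck) :
    (c.addJeep B C (m₁ + n₁)).Balanced B C d n₁ n₂ m₁ w (c.pos :: L) where
  num_eq := by simp [Convoy.addJeep, hc.num_eq]; omega
  single_eq := addJeep_single (by rw [hc.num_eq]; omega) hc.single_eq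
  pos_le := hc.pos_le
  pos_le_mem a ha := by
    rcases List.mem_cons.1 ha with rfl | ha
    · rfl
    · exact hc.pos_le_mem a ha
  tank_nonneg j := by
    simp only [Convoy.addJeep, Function.update_apply]
    split_ifs
    · norm_num
    · exact hc.tank_nonneg j
  tank_eq_zero j hj := by
    simp only [Convoy.addJeep] at *
    rw [Function.update_of_ne (by omega)]
    exact hc.tank_eq_zero j (by omega)
  cans_nonneg := by
    simp only [Convoy.addJeep]
    have := hc.cans_nonneg
    positivity
  todo_eq := hc.todo_eq
  certified := by
    refine ⟨hc.certified, hc.pos_le, ?_⟩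
    classical
    have hex : ∃ m, m = c.num ∨ c.tank m ≠ 0 := ⟨c.num, Or.inl rfl⟩
    have hm := Nat.find_spec hex
    have hlt : ∀ j < Nat.find hex, c.tank j = 0 := fun j hj => by
      by_contra h'
      exact Nat.find_min hex hj (Or.inr h')
    have hle : Nat.find hex ≤ c.num := Nat.find_min' hex (Or.inl rfl)
    set m := Nat.find hex
    have hb := hc.balance m hle hm
    rw [Finset.sum_congr rfl (g := fun _ => (-1 : ℝ)) (fun j hj => by
      rw [hlt j (Finset.mem_range.1 hj), zero_sub])] at hb
    simp only [Finset.sum_const, Finset.card_range, nsmul_eq_mul, mul_neg, mul_one] at hb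
    refine ⟨m, fun y _ hy => ?_⟩
    have hwb := hc.le_weightBeyond hw hy
    have hds : demand d (n₁ + n₂) (fun k => slope n₁ n₂ m₁ m k) L y =
      demand d (n₁ + n₂) (fun k => slope n₁ n₂ m₁ m k) L c.pos + (c.pos - y) *
        ((slope n₁ n₂ m₁ m c.num : ℕ) : ℝ) := by
      have := demand_sub (d := d) (n := n₁ + n₂) (f := fun k => (slope n₁ n₂ m₁ m k : ℝ))
        hc.pos_le_mem (sub_nonneg.2 hy.le)
      rw [sub_sub_cancel] at this
      rw [this, hc.num_eq]
    rw [← hc.num_eq, hds]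
    rcases h with h | ⟨i, hi, hi', hc0⟩
    · have : 0 ≤ (c.pos - y) * ((slope n₁ n₂ m₁ m c.num : ℕ) : ℝ) :=
        mul_nonneg (sub_nonneg.2 hy.le) (Nat.cast_nonneg _)
      linarith
    · have him : i < m := by
        by_contra h'
        rcases hm with hm | hm
        · omega
        · exact hm (hi' m (by omega))
      have : 0 < (c.pos - y) * ((slope n₁ n₂ m₁ m c.num : ℕ) : ℝ) := by
        refine mul_pos (sub_pos.2 hy) (Nat.cast_pos.2 ?_)
        unfold slope; omega
      have htodo : 0 ≤ c.todo c.pos := by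
        rcases hc.todo_eq c.pos with h | h
        · rw [h]; exact hw _
        · rw [h.1]
      linarith
  balance m hm hm' := by
    simp only [Convoy.addJeep] at *
    have hdem : demand d (n₁ + n₂) (fun k => slope n₁ n₂ m₁ m k) (c.pos :: L) c.pos =
        demand d (n₁ + n₂) (fun k => slope n₁ n₂ m₁ m k) L c.pos := by
      simp [demand]
    have hsum : ∀ q ≤ c.num, ∑ j ∈ Finset.range q, (Function.update c.tank c.num 1 j - 1) =
        ∑ j ∈ Finset.range q, (c.tank j - 1) := fun q hq =>
      Finset.sum_congr rfl fun j hj => by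
        rw [Finset.mem_range] at hj
        rw [Function.update_of_ne (by omega)]
    rw [hdem]
    push_cast
    rcases Nat.lt_or_ge c.num m with hlt | hge
    · obtain rfl : m = c.num + 1 := by omega
      have hb := hc.balance c.num le_rfl (Or.inl rfl)
      rw [Finset.sum_range_succ, hsum _ le_rfl, Function.update_self,
        demand_slope_congr (m' := c.num) (by rw [hc.num_eq]; omega) (by rw [hc.num_eq])]
      linarith
    · have hb := hc.balance m hge (by
        rcases eq_or_ne m c.num with h | h
        · exact Or.inl h
        · rw [Function.update_of_ne h] at hm'
          exact Or.inr (hm'.resolve_left (by omega)))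
      rw [hsum m hge]
      linarith

lemma exists_balanced {B : ℕ} {C d : ℝ} {n₁ n₂ m₁ : ℕ} {w : ℝ →₀ ℝ} {c : Convoy}
    (hC : 0 < C) (hw : ∀ p, 0 ≤ w p)
    (h : Relation.ReflTransGen (Convoy.Step B C (m₁ + n₁)) (initial B C d n₁ n₂ w) c) :
    ∃ L, c.Balanced B C d n₁ n₂ m₁ w L := by
  induction h with
  | refl => exact ⟨[], balanced_initial hC⟩
  | tail _ hs ih =>
    obtain ⟨L, hL⟩ := ih
    cases hs with
    | ride h hh hpos hdepot htank hcans => exact ⟨L, hL.ride hh htank hcans⟩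
    | fillDepot hdepot hcans => exact ⟨L, hL.fillDepot hcans⟩
    | addForDepot hcans => exact ⟨_, hL.addJeep hC hw (Or.inl hcans)⟩
    | addForRide hpos hstuck => exact ⟨_, hL.addJeep hC hw (Or.inr hstuck)⟩

end Convoy

/-- The result of the algorithm in terms of the positions where jeeps are added. -/
lemma AlgorithmResult.exists_certified {B : ℕ} {C d : ℝ} {n₁ n₂ m₁ : ℕ} {w : ℝ →₀ ℝ} {r : ℝ}
    (hC : 0 < C) (hw : ∀ p, 0 ≤ w p) (h : AlgorithmResult B C d n₁ n₂ m₁ w r) :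
    ∃ L, Certified B C d n₁ n₂ m₁ w L ∧
      ∀ m, n₁ + n₂ + L.length ≤ m →
        r ≤ demand d (n₁ + n₂) (fun k => slope n₁ n₂ m₁ m k) L 0 + w.sum fun _ q => q := by
  obtain ⟨c, hc, hpos, rfl⟩ := h
  obtain ⟨L, hL⟩ := Convoy.exists_balanced hC hw hc
  refine ⟨L, hL.certified, fun m hm => ?_⟩
  have hb := hL.balance c.num le_rfl (Or.inl rfl)
  rw [demand_slope_congr (m' := m) (by rw [hL.num_eq]) hm, hpos, Finset.sum_sub_distrib] at hb
  have htodo : 0 ≤ c.todo.sum fun _ q => q := by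
    refine Finset.sum_nonneg fun p _ => ?_
    rcases hL.todo_eq p with h | h
    · rw [h]; exact hw p
    · rw [h.1]
  simp at hb
  linarith

namespace Convoy

/-- The properties of a convoy that let the algorithm go on. -/
structure Ready (c : Convoy) : Prop where
  pos_nonneg : 0 ≤ c.pos
  cans_nonneg : 0 ≤ c.cans
  tank_nonneg : ∀ j, 0 ≤ c.tank j
  todo_eq_zero : ∀ p, c.pos < p → c.todo p = 0
  todo_nonneg : ∀ p, 0 ≤ c.todo p
  pos_of_todo : ∀ p, c.todo p ≠ 0 → 0 < p

open Classical in
/-- The number of nonempty sources of fuel. -/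
noncomputable def sources (c : Convoy) : ℕ :=
  ((Finset.range c.num).filter fun j => c.tank j ≠ 0).card + if c.cans ≠ 0 then 1 else 0

lemma Ready.addJeep {B : ℕ} {C : ℝ} {s : ℕ} {c : Convoy} (hC : 0 < C) (hc : c.Ready) :
    (c.addJeep B C s).Ready where
  pos_nonneg := hc.pos_nonneg
  cans_nonneg := by
    have := hc.cans_nonneg
    simp only [Convoy.addJeep]; positivity
  tank_nonneg j := by
    simp only [Convoy.addJeep, Function.update_apply]
    split_ifs
    · norm_num
    · exact hc.tank_nonneg j
  todo_eq_zero := hc.todo_eq_zero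
  todo_nonneg := hc.todo_nonneg
  pos_of_todo := hc.pos_of_todo

/-- The next ride ends at a given target or with the exhaustion of a source of fuel. -/
lemma Ready.exists_ride {B : ℕ} {C : ℝ} {s : ℕ} {c : Convoy} (hc : c.Ready) (hs : ¬ c.Stuck)
    {q : ℝ} (hq : 0 ≤ q) (hqc : q < c.pos) (hdepot : ∀ p, q < p → c.todo p = 0) :
    ∃ h, 0 < h ∧ h ≤ c.pos - q ∧ h * c.canRate ≤ c.cans ∧ Step B C s c (c.ride h) ∧
      (c.ride h).Ready ∧ (h = c.pos - q ∨ (c.ride h).sources < c.sources) := by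
  classical
  have hcr : 0 < c.canRate → 0 < c.cans := by
    intro h
    obtain ⟨i, hi, _⟩ := Finset.exists_ne_zero_of_sum_ne_zero h.ne'
    rw [Finset.mem_filter, Finset.mem_range] at hi
    refine hc.cans_nonneg.lt_of_ne fun h0 => hs ⟨i, hi.1, hi.2, h0.symm⟩
  have htr : ∀ j, 0 < c.tankRate j → 0 < c.tank j := fun j h =>
    (hc.tank_nonneg j).lt_of_ne fun h0 => h.ne' (tankRate_eq_zero h0.symm)
  let F : Finset ℝ := insert (c.pos - q) (((Finset.range c.num).filter fun j =>
    0 < c.tankRate j).image (fun j => c.tank j / c.tankRate j) ∪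
      if 0 < c.canRate then {c.cans / c.canRate} else ∅)
  have hF : F.Nonempty := ⟨_, Finset.mem_insert_self _ _⟩
  have hmem : ∀ x, x ∈ F ↔ x = c.pos - q ∨
      (∃ j < c.num, 0 < c.tankRate j ∧ x = c.tank j / c.tankRate j) ∨
      (0 < c.canRate ∧ x = c.cans / c.canRate) := by
    intro x
    simp only [F, Finset.mem_insert, Finset.mem_union, Finset.mem_image, Finset.mem_filter,
      Finset.mem_range]
    refine or_congr Iff.rfl (or_congr ⟨?_, ?_⟩ ?_)
    · rintro ⟨j, ⟨h1, h2⟩, h3⟩; exact ⟨j, h1, h2, h3.symm⟩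
    · rintro ⟨j, h1, h2, h3⟩; exact ⟨j, ⟨h1, h2⟩, h3.symm⟩
    · split_ifs with h <;> simp [h]
  set h := F.min' hF with hh
  have hle : ∀ x ∈ F, h ≤ x := fun x hx => F.min'_le x hx
  have hhF : h ∈ F := F.min'_mem hF
  have hpos : 0 < h := by
    rcases (hmem h).1 hhF with h1 | ⟨j, _, h1, h2⟩ | ⟨h1, h2⟩
    · rw [h1]; exact sub_pos.2 hqc
    · rw [h2]; exact div_pos (htr j h1) h1
    · rw [h2]; exact div_pos (hcr h1) h1
  have hle1 : h ≤ c.pos - q := hle _ ((hmem _).2 (Or.inl rfl))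
  have htank : ∀ j < c.num, h * c.tankRate j ≤ c.tank j := by
    intro j hj
    rcases (c.tankRate_nonneg j).eq_or_lt with h0 | h0
    · rw [← h0, mul_zero]; exact hc.tank_nonneg j
    · exact (le_div_iff₀ h0).1 (hle _ ((hmem _).2 (Or.inr (Or.inl ⟨j, hj, h0, rfl⟩))))
  have hcans : h * c.canRate ≤ c.cans := by
    rcases c.canRate_nonneg.eq_or_lt with h0 | h0
    · rw [← h0, mul_zero]; exact hc.cans_nonneg
    · exact (le_div_iff₀ h0).1 (hle _ ((hmem _).2 (Or.inr (Or.inr ⟨h0, rfl⟩))))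
  have hsub : ((Finset.range c.num).filter fun j => (c.ride h).tank j ≠ 0) ⊆
      ((Finset.range c.num).filter fun j => c.tank j ≠ 0) := by
    intro j hj
    rw [Finset.mem_filter] at hj ⊢
    refine ⟨hj.1, fun h0 => hj.2 ?_⟩
    simp [Convoy.ride, h0, tankRate_eq_zero h0]
  have hcsub : (c.ride h).cans ≠ 0 → c.cans ≠ 0 := by
    intro h1 h2
    apply h1
    have h3 : c.canRate = 0 := by
      by_contra h3
      exact (hcr (c.canRate_nonneg.lt_of_ne' h3)).ne' h2
    simp [Convoy.ride, h2, h3]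
  refine ⟨h, hpos, hle1, hcans, ?_, ?_, ?_⟩
  · exact Step.ride c h hpos (by linarith) (fun p hp => hdepot p (by linarith)) htank hcans
  · exact
      { pos_nonneg := by simp only [Convoy.ride]; linarith
        cans_nonneg := by simp only [Convoy.ride]; linarith
        tank_nonneg := fun j => by
          simp only [Convoy.ride]
          by_cases hj : j < c.num
          · linarith [htank j hj]
          · rw [tankRate_eq_zero_of_le (by omega), mul_zero, sub_zero]; exact hc.tank_nonneg j
        todo_eq_zero := fun p hp => hdepot p (by simp only [Convoy.ride] at hp; linarith)
        todo_nonneg := hc.todo_nonneg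
        pos_of_todo := hc.pos_of_todo }
  · rcases (hmem h).1 hhF with h1 | ⟨j, hj, h1, h2⟩ | ⟨h1, h2⟩
    · exact Or.inl h1
    · right
      refine Nat.add_lt_add_of_lt_of_le (Finset.card_lt_card ⟨hsub, fun hsup => ?_⟩) ?_
      · have := hsup (Finset.mem_filter.2 ⟨Finset.mem_range.2 hj, (htr j h1).ne'⟩)
        refine (Finset.mem_filter.1 this).2 ?_
        simp only [Convoy.ride]
        rw [h2, div_mul_cancel₀ _ h1.ne', sub_self]
      · by_cases h0 : (c.ride h).cans ≠ 0
        · rw [if_pos h0, if_pos (hcsub h0)]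
        · rw [if_neg h0]; exact Nat.zero_le _
    · right
      refine Nat.add_lt_add_of_le_of_lt (Finset.card_le_card hsub) ?_
      rw [if_neg, if_pos (hcr h1).ne']
      · exact Nat.zero_lt_one
      · simp only [Convoy.ride]
        rw [h2, div_mul_cancel₀ _ h1.ne', sub_self]; simp

/-- If no depots are on the way, then the algorithm reaches any position that is not farther than
the distances for which the can fuel of `t` additional jeeps suffices. -/
lemma Ready.exists_reach_of_le {B : ℕ} {C : ℝ} {s : ℕ} (hC : 0 < C) {q : ℝ}
    (hq : 0 ≤ q) (t μ : ℕ) {c : Convoy} (hc : c.Ready) (hqc : q ≤ c.pos)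
    (hdepot : ∀ p, q < p → c.todo p = 0) (hμ : c.sources ≤ μ)
    (hdist : c.pos - q ≤ c.cans / (2 * (c.num + 1)) +
      ∑ i ∈ Finset.range t, B * C / (2 * (c.num + 1 + (i + 1)))) :
    ∃ c', Relation.ReflTransGen (Step B C s) c c' ∧ c'.Ready ∧ c'.pos = q ∧ c'.todo = c.todo := by
  induction t generalizing c μ with
  | zero =>
    induction μ using Nat.strong_induction_on generalizing c with
    | _ μ ih =>
    rcases hqc.eq_or_lt with h0 | h0
    · exact ⟨c, .refl, hc, h0.symm, rfl⟩
    have hs : ¬ c.Stuck := by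
      rintro ⟨_, _, _, h1⟩
      rw [h1] at hdist
      simp at hdist
      linarith
    obtain ⟨h, hh, hle, hcan, hstep, hr, hor⟩ :=
      hc.exists_ride (B := B) (C := C) (s := s) hs hq h0 hdepot
    rcases hor with rfl | hlt
    · exact ⟨_, .single hstep, hr, by simp [Convoy.ride], rfl⟩
    · obtain ⟨c', h1, h2⟩ := ih _ (hlt.trans_le hμ) hr (by simp only [Convoy.ride]; linarith)
        hdepot le_rfl (by
          simp only [Convoy.ride, Finset.range_zero, Finset.sum_empty, add_zero] at *
          have h3 := c.canRate_le
          rw [le_div_iff₀ (by positivity)] at *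
          nlinarith)
      exact ⟨c', .head hstep h1, h2⟩
  | succ t iht =>
    induction μ using Nat.strong_induction_on generalizing c with
    | _ μ ih =>
    rcases hqc.eq_or_lt with h0 | h0
    · exact ⟨c, .refl, hc, h0.symm, rfl⟩
    by_cases hs : c.Stuck
    · have hstep : Step B C s c (c.addJeep B C s) := .addForRide c (hq.trans_lt h0) hs
      obtain ⟨_, _, _, h1⟩ := hs
      obtain ⟨c', h2, h3⟩ := iht _ (hc.addJeep (B := B) (s := s) hC) hqc hdepot le_rfl (by
        rw [Finset.sum_range_succ', h1] at hdist
        simp only [Convoy.addJeep, h1]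
        push_cast at *
        simp only [zero_div, zero_add, add_assoc] at *
        rw [add_comm]
        convert hdist using 5
        ring)
      exact ⟨c', .head hstep h2, h3⟩
    obtain ⟨h, hh, hle, hcan, hstep, hr, hor⟩ :=
      hc.exists_ride (B := B) (C := C) (s := s) hs hq h0 hdepot
    rcases hor with rfl | hlt
    · exact ⟨_, .single hstep, hr, by simp [Convoy.ride], rfl⟩
    · obtain ⟨c', h1, h2⟩ := ih _ (hlt.trans_le hμ) hr (by simp only [Convoy.ride]; linarith)
        hdepot le_rfl (by
          simp only [Convoy.ride] at *
          have h3 := c.canRate_le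
          have h4 : (c.cans - h * c.canRate) / (2 * (c.num + 1)) ≥
              c.cans / (2 * (c.num + 1)) - h := by
            rw [ge_iff_le, sub_div]
            have : h * c.canRate / (2 * (c.num + 1)) ≤ h := by
              rw [div_le_iff₀ (by positivity)]
              nlinarith
            linarith
          linarith)
      exact ⟨c', .head hstep h1, h2⟩

lemma Ready.exists_reach {B : ℕ} {C : ℝ} {s : ℕ} (hB : 0 < B) (hC : 0 < C) {q : ℝ}
    (hq : 0 ≤ q) {c : Convoy} (hc : c.Ready) (hqc : q ≤ c.pos)
    (hdepot : ∀ p, q < p → c.todo p = 0) :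
    ∃ c', Relation.ReflTransGen (Step B C s) c c' ∧ c'.Ready ∧ c'.pos = q ∧ c'.todo = c.todo := by
  have hBC : 0 < B * C / 2 := by positivity
  have hdiv : Filter.Tendsto (fun t => ∑ i ∈ Finset.range t, (1 / ((i : ℝ) + 1)))
      Filter.atTop Filter.atTop := Real.tendsto_sum_range_one_div_nat_succ_atTop
  obtain ⟨t, ht⟩ := (Filter.tendsto_atTop.1 hdiv ((c.pos - q) / (B * C / 2) +
    ∑ i ∈ Finset.range (c.num + 1), (1 / ((i : ℝ) + 1)))).and
      (Filter.eventually_ge_atTop (c.num + 1)) |>.exists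
  obtain ⟨u, rfl⟩ := Nat.exists_eq_add_of_le ht.2
  have h1 := ht.1
  rw [Finset.sum_range_add _ (c.num + 1) u, add_comm, add_le_add_iff_left, div_le_iff₀ hBC, Finset.sum_mul] at h1
  refine hc.exists_reach_of_le hC hq u _ hqc hdepot le_rfl (h1.trans ?_)
  have h2 : 0 ≤ c.cans / (2 * (c.num + 1)) := div_nonneg hc.cans_nonneg (by positivity)
  refine le_add_of_nonneg_of_le h2 (Finset.sum_le_sum fun i _ => le_of_eq ?_)
  push_cast
  field_simp
  ring

lemma Ready.exists_fillDepot {B : ℕ} {C : ℝ} {s : ℕ} (hB : 0 < B) (hC : 0 < C) {c : Convoy}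
    (hc : c.Ready) (hdepot : c.todo c.pos ≠ 0) :
    ∃ c', Relation.ReflTransGen (Step B C s) c c' ∧ c'.Ready ∧ c'.pos = c.pos ∧
      c'.todo = c.todo.erase c.pos := by
  have hBC : 0 < B * C := by positivity
  obtain ⟨t, ht⟩ := Archimedean.arch (c.todo c.pos) hBC
  replace ht : c.todo c.pos ≤ c.cans + t * (B * C) := by
    rw [nsmul_eq_mul] at ht
    linarith [hc.cans_nonneg]
  induction t generalizing c with
  | zero =>
    simp only [Nat.cast_zero, zero_mul, add_zero] at ht
    refine ⟨_, .single (.fillDepot c hdepot ht), ?_, rfl, rfl⟩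
    have he : ∀ p, c.fillDepot.todo p = 0 ∨ c.fillDepot.todo p = c.todo p := by
      intro p
      simp only [Convoy.fillDepot]
      by_cases hp : p = c.pos
      · subst hp; left; simp
      · right; rw [Finsupp.erase_ne hp]
    exact
      { pos_nonneg := hc.pos_nonneg
        cans_nonneg := by simp only [Convoy.fillDepot]; linarith
        tank_nonneg := hc.tank_nonneg
        todo_eq_zero := fun p hp => (he p).elim id fun h => h.trans (hc.todo_eq_zero p hp)
        todo_nonneg := fun p => (he p).elim (fun h => h.ge) fun h => h ▸ hc.todo_nonneg p
        pos_of_todo := fun p hp => hc.pos_of_todo p ((he p).resolve_left hp ▸ hp) }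
  | succ t ih =>
    rcases le_or_gt (c.todo c.pos) c.cans with h | h
    · exact ih hc hdepot (by nlinarith [(Nat.cast_nonneg t : (0 : ℝ) ≤ t)])
    · obtain ⟨c', h1, h2⟩ := ih (hc.addJeep (B := B) (s := s) hC) hdepot (by
        simp only [Convoy.addJeep]
        push_cast at ht
        linarith)
      exact ⟨c', .head (.addForDepot c h) h1, h2⟩

lemma Ready.exists_reach_border {B : ℕ} {C : ℝ} {s : ℕ} (hB : 0 < B) (hC : 0 < C) {c : Convoy}
    (hc : c.Ready) : ∃ c', Relation.ReflTransGen (Step B C s) c c' ∧ c'.pos = 0 := by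
  induction hn : c.todo.support.card generalizing c with
  | zero =>
    have h0 : c.todo = 0 := by simpa using hn
    obtain ⟨c', h1, _, h2, _⟩ := hc.exists_reach (s := s) hB hC le_rfl hc.pos_nonneg
      (fun p _ => by simp [h0])
    exact ⟨c', h1, h2⟩
  | succ n ih =>
    have hne : c.todo.support.Nonempty := Finset.card_pos.1 (by omega)
    set q := c.todo.support.max' hne
    have hq : q ∈ c.todo.support := Finset.max'_mem _ _
    have hq' := Finsupp.mem_support_iff.1 hq
    obtain ⟨c₁, h1, hr1, hp1, ht1⟩ := hc.exists_reach (s := s) hB hC (hc.pos_of_todo q hq').le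
      (not_lt.1 fun h => hq' (hc.todo_eq_zero q h))
      (fun p hp => by
        by_contra h
        exact (Finset.le_max' _ p (Finsupp.mem_support_iff.2 h)).not_gt hp)
    obtain ⟨c₂, h2, hr2, hp2, ht2⟩ := hr1.exists_fillDepot (s := s) hB hC (by rwa [hp1, ht1])
    obtain ⟨c₃, h3, hp3⟩ := ih hr2 (by
      rw [ht2, Finsupp.support_erase, Finset.card_erase_of_mem (by rwa [hp1, ht1]), ht1, hn]
      omega)
    exact ⟨c₃, (h1.trans h2).trans h3, hp3⟩

end Convoy

/-- The algorithm reaches the desert border. -/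
lemma exists_algorithmResult {B : ℕ} {C d : ℝ} {n₁ n₂ m₁ : ℕ} {w : ℝ →₀ ℝ} (hB : 0 < B)
    (hC : 0 < C) (hd : 0 < d) (hw : ∀ p, 0 ≤ w p) (hpos : ∀ p, w p ≠ 0 → 0 < p ∧ p ≤ d) :
    ∃ r, AlgorithmResult B C d n₁ n₂ m₁ w r := by
  have hr : (Convoy.initial B C d n₁ n₂ w).Ready :=
    { pos_nonneg := hd.le
      cans_nonneg := by simp only [Convoy.initial]; positivity
      tank_nonneg := fun j => by simp only [Convoy.initial]; split_ifs <;> norm_num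
      todo_eq_zero := fun p hp => by
        by_contra h
        exact (hpos p h).2.not_gt hp
      todo_nonneg := hw
      pos_of_todo := fun p hp => (hpos p hp).1 }
  obtain ⟨c, h1, h2⟩ := hr.exists_reach_border (s := m₁ + n₁) hB hC
  exact ⟨_, c, h1, h2, rfl⟩

/-! ### Extended backward convoy algorithms -/

/-- The tank fuel of a jeep above the initial level, where a lack of fuel only counts for marked
jeeps. -/
noncomputable def excess (z : ExtJeep × Bool) : ℝ :=
  if z.2 then z.1.tank - 1 else max (z.1.tank - 1) 0

/-- The number of marked jeeps. -/
def markCount (M : List (ExtJeep × Bool)) : ℕ := M.countP fun z => z.2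

/-- The number of marked jeeps of the round trips. -/
def markRound (M : List (ExtJeep × Bool)) : ℕ :=
  M.countP fun z => z.2 && decide (z.1.kind = .round)

lemma sub_one_le_excess (z : ExtJeep × Bool) : z.1.tank - 1 ≤ excess z := by
  unfold excess; split_ifs
  · rfl
  · exact le_max_left _ _

lemma countKind_cons (κ : Kind) (a : ExtJeep) (l : List ExtJeep) :
    countKind κ (a :: l) = countKind κ l + if a.kind = κ then 1 else 0 := by
  simp [countKind, List.count_cons]

lemma markCount_cons (z : ExtJeep × Bool) (M : List (ExtJeep × Bool)) :
    markCount (z :: M) = markCount M + if z.2 then 1 else 0 := by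
  simp [markCount, List.countP_cons]

lemma markRound_cons (z : ExtJeep × Bool) (M : List (ExtJeep × Bool)) :
    markRound (z :: M) = markRound M + if z.2 ∧ z.1.kind = .round then 1 else 0 := by
  simp [markRound, List.countP_cons]

lemma markCount_le (M : List (ExtJeep × Bool)) : markCount M ≤ M.length :=
  List.countP_le_length

/-- More jeeps can be marked without increasing the total excess. -/
lemma exists_mark (M : List (ExtJeep × Bool)) (q : ℕ) (h1 : markCount M ≤ q)
    (h2 : q ≤ M.length) :
    ∃ M' : List (ExtJeep × Bool), M'.map Prod.fst = M.map Prod.fst ∧ markCount M' = q ∧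
      markRound M ≤ markRound M' ∧ (M'.map excess).sum ≤ (M.map excess).sum := by
  induction M generalizing q with
  | nil =>
    have : q = 0 := by simpa using h2
    exact ⟨[], rfl, by simp [markCount, this], le_rfl, le_rfl⟩
  | cons z M ih =>
    obtain ⟨a, b⟩ := z
    rw [markCount_cons] at h1
    rw [List.length_cons] at h2
    have hM := markCount_le M
    rcases Nat.lt_or_ge M.length q with hq | hq
    · obtain ⟨M', e1, e2, e3, e4⟩ := ih (q - 1) (by omega) (by omega)
      refine ⟨(a, true) :: M', by simp [e1], ?_, ?_, ?_⟩
      · rw [markCount_cons, e2]; simp; omega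
      · rw [markRound_cons, markRound_cons]
        refine Nat.add_le_add e3 ?_
        cases b <;> simp
      · rw [List.map_cons, List.map_cons, List.sum_cons, List.sum_cons]
        exact add_le_add (sub_one_le_excess (a, b)) e4
    · cases b with
      | true =>
        simp only [if_true] at h1
        obtain ⟨M', e1, e2, e3, e4⟩ := ih (q - 1) (by omega) (by omega)
        refine ⟨(a, true) :: M', by simp [e1], ?_, ?_, ?_⟩
        · rw [markCount_cons, e2]; simp; omega
        · rw [markRound_cons, markRound_cons]; exact Nat.add_le_add_right e3 _
        · simpa using e4
      | false =>
        simp only [Bool.false_eq_true, if_false, add_zero] at h1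
        obtain ⟨M', e1, e2, e3, e4⟩ := ih q h1 hq
        refine ⟨(a, false) :: M', by simp [e1], ?_, ?_, ?_⟩
        · rw [markCount_cons, e2]; simp
        · rw [markRound_cons, markRound_cons]; exact Nat.add_le_add_right e3 _
        · simpa using e4

lemma exists_perm_map_eq {α β : Type*} (f : α → β) {l l' : List β} (h : l.Perm l') :
    ∀ M : List α, M.map f = l → ∃ M', M.Perm M' ∧ M'.map f = l' := by
  induction h with
  | nil => exact fun M hM => ⟨M, .refl _, hM⟩
  | cons x _ ih =>
    intro M hM
    obtain ⟨a, M, rfl, rfl, h2⟩ := List.map_eq_cons_iff.1 hM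
    obtain ⟨M', h3, h4⟩ := ih M h2
    exact ⟨a :: M', h3.cons a, by simp [h4]⟩
  | swap x y l =>
    intro M hM
    obtain ⟨a, M, rfl, rfl, h2⟩ := List.map_eq_cons_iff.1 hM
    obtain ⟨b, M, rfl, rfl, rfl⟩ := List.map_eq_cons_iff.1 h2
    exact ⟨b :: a :: M, .swap _ _ _, rfl⟩
  | trans _ _ ih1 ih2 =>
    intro M hM
    obtain ⟨M', h1, h2⟩ := ih1 M hM
    obtain ⟨M'', h3, h4⟩ := ih2 M' h2
    exact ⟨M'', h1.trans h3, h4⟩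

/-- The excess of the marked jeeps can be estimated by the demand up to the current position. -/
def MarkBound (B : ℕ) (C d : ℝ) (n₁ n₂ m₁ : ℕ) (w : ℝ →₀ ℝ) (L : List ℝ) (c : ExtConvoy) (m : ℕ) :
    Prop :=
  ∃ M : List (ExtJeep × Bool), M.map Prod.fst = c.jeeps ∧ markCount M = min m M.length ∧
    (n₂ ≤ countKind .round c.jeeps → min m n₂ ≤ markRound M) ∧
    demand d (n₁ + n₂) (fun k => slope n₁ n₂ m₁ m k) L c.pos +
      ((w.sum fun _ q => q) - c.todo.sum fun _ q => q) + c.cans + (M.map excess).sum ≤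
      c.jeeps.length * (B * C)

/-- Elementary properties of extended backward convoys. -/
structure ExtConvoy.Proper (d : ℝ) (n₂ : ℕ) (w : ℝ →₀ ℝ) (c : ExtConvoy) : Prop where
  pos_le : c.pos ≤ d
  cans_nonneg : 0 ≤ c.cans
  tank_nonneg : ∀ a ∈ c.jeeps, 0 ≤ a.tank
  todo_eq : ∀ p, c.todo p = w p ∨ c.todo p = 0
  todo_eq_zero : ∀ p, c.pos < p → c.todo p = 0
  round_le : countKind .round c.jeeps ≤ n₂

lemma countKind_replicate (κ κ' : Kind) (n : ℕ) (t : ℝ) :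
    countKind κ (List.replicate n ⟨κ', t⟩) = if κ' = κ then n else 0 := by
  simp [countKind, List.count_replicate]

lemma countKind_append (κ : Kind) (l l' : List ExtJeep) :
    countKind κ (l ++ l') = countKind κ l + countKind κ l' := by
  simp [countKind]

lemma ExtConvoy.proper_initial {B : ℕ} {C d : ℝ} {n₁ n₂ : ℕ} {w : ℝ →₀ ℝ} (hC : 0 < C)
    (hpos : ∀ p, w p ≠ 0 → 0 < p ∧ p ≤ d) :
    (ExtConvoy.initial B C d n₁ n₂ w).Proper d n₂ w where
  pos_le := le_rfl
  cans_nonneg := by simp only [initial]; positivity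
  tank_nonneg a ha := by
    simp only [initial, List.mem_append, List.mem_replicate] at ha
    rcases ha with ⟨_, rfl⟩ | ⟨_, rfl⟩ <;> simp
  todo_eq p := Or.inl rfl
  todo_eq_zero p hp := by
    by_contra h
    exact (hpos p h).2.not_gt hp
  round_le := by simp [initial, countKind_append, countKind_replicate]

lemma countKind_forall₂ {κ : Kind} {R : ExtJeep → ExtJeep → Prop}
    (hR : ∀ a b, R a b → b.kind = a.kind) {l l' : List ExtJeep} (h : List.Forall₂ R l l') :
    countKind κ l' = countKind κ l := by
  induction h with
  | nil => rfl
  | cons h _ ih => rw [countKind_cons, countKind_cons, ih, hR _ _ h]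

lemma ExtConvoy.Proper.step {B : ℕ} {C d : ℝ} {n₁ n₂ m₁ : ℕ} {w : ℝ →₀ ℝ} {c c' : ExtConvoy}
    (hC : 0 < C) (hc : c.Proper d n₂ w)
    (h : ExtStep B C n₁ n₂ m₁ c c') : c'.Proper d n₂ w := by
  have hBC : 0 ≤ B * C := by positivity
  obtain ⟨h1, h2, h3, h4, h5, h6⟩ := hc
  cases h with
  | ride h l hh hpos hdepot hadm hl hcans =>
    refine ⟨by simp only; linarith, by simp only; linarith, ?_, h4, hdepot, ?_⟩
    · have : ∀ b ∈ l, 0 ≤ b.tank := by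
        intro b hb
        obtain ⟨i, hi, rfl⟩ := List.getElem_of_mem hb
        have hlen := hl.length_eq
        exact (List.Forall₂.get hl (i := i) (by omega) hi).2.1
      exact this
    · rw [countKind_forall₂ (fun a b h => h.1) hl]; exact h6
  | fillDepot hdepot hcans =>
    refine ⟨h1, by simp only; linarith, h3, ?_, ?_, h6⟩
    all_goals
      intro p
      dsimp only
      by_cases hp : p = c.pos
      · subst hp; simp
      · rw [Finsupp.erase_ne hp]
        first | exact h4 p | exact h5 p
  | add κ hκ =>
    refine ⟨h1, by simp only; linarith, ?_, h4, h5, ?_⟩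
    · intro a ha
      rcases List.mem_cons.1 ha with rfl | ha
      · simp
      · exact h3 a ha
    · rw [countKind_cons]; simpa [hκ] using h6
  | replace a l hl ha =>
    rw [hl] at h3 h6
    refine ⟨h1, h2, ?_, h4, h5, ?_⟩
    · simpa using h3
    · rw [countKind_cons] at h6 ⊢; simp; omega
  | refuel a l q hl hq hcans ha =>
    rw [hl] at h3 h6
    refine ⟨h1, by simp only; linarith, ?_, h4, h5, ?_⟩
    · have := h3 a (by simp)
      intro b hb
      rcases List.mem_cons.1 hb with rfl | hb
      · simp only; linarith
      · exact h3 b (by simp [hb])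
    · rw [countKind_cons] at h6 ⊢; exact h6
  | mergeSingle a b l hl ha hb h1' h2' hcans =>
    rw [hl] at h3 h6
    refine ⟨h1, by simp only; linarith, ?_, h4, h5, ?_⟩
    · intro e he
      rcases List.mem_cons.1 he with rfl | he
      · simp only; linarith
      · exact h3 e (by simp [he])
    · rw [countKind_cons, countKind_cons] at h6; rw [countKind_cons]; simp; omega
  | mergeDouble a b l hl ha hb h1' h2' hcans =>
    rw [hl] at h3 h6
    refine ⟨h1, by simp only; linarith, ?_, h4, h5, ?_⟩
    · intro e he
      rcases List.mem_cons.1 he with rfl | he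
      · simp only; linarith
      · exact h3 e (by simp [he])
    · rw [countKind_cons, countKind_cons] at h6
      rw [countKind_cons]
      by_cases hk : a.kind = .round <;> by_cases hk' : b.kind = .round <;>
        simp [hk, hk'] at * <;> omega
  | perm l hl =>
    refine ⟨h1, h2, fun a ha => h3 a (hl.mem_iff.2 ha), h4, h5, ?_⟩
    have : countKind .round l = countKind .round c.jeeps := (hl.map _).count_eq _ |>.symm
    rw [this]; exact h6

lemma ExtConvoy.Proper.weightBeyond_le {d : ℝ} {n₂ : ℕ} {w : ℝ →₀ ℝ} {c : ExtConvoy}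
    (hc : c.Proper d n₂ w) (hw : ∀ p, 0 ≤ w p) :
    weightBeyond w c.pos ≤ (w.sum fun _ q => q) - c.todo.sum fun _ q => q := by
  have hsub : c.todo.support ⊆ w.support := by
    intro p hp
    rw [Finsupp.mem_support_iff] at *
    rcases hc.todo_eq p with h | h
    · rwa [← h]
    · exact absurd h hp
  rw [Convoy.weightBeyond_eq_sum, Finsupp.sum_of_support_subset c.todo hsub _ (by simp)]
  unfold Finsupp.sum
  rw [← Finset.sum_sub_distrib]
  refine Finset.sum_le_sum fun p _ => ?_
  have := hw p
  dsimp only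
  split_ifs with h
  · rw [hc.todo_eq_zero p h]; linarith
  · rcases hc.todo_eq p with h | h <;> rw [h] <;> linarith

lemma MarkBound.initial {B : ℕ} {C d : ℝ} {n₁ n₂ m₁ : ℕ} {w : ℝ →₀ ℝ} {L : List ℝ}
    (hL : Certified B C d n₁ n₂ m₁ w L) (m : ℕ) :
    MarkBound B C d n₁ n₂ m₁ w L (ExtConvoy.initial B C d n₁ n₂ w) m := by
  have hdem : ∀ L, Certified B C d n₁ n₂ m₁ w L →
      demand d (n₁ + n₂) (fun k => slope n₁ n₂ m₁ m k) L d = 0 := by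
    intro L
    induction L with
    | nil => simp [demand]
    | cons a L ih =>
      intro h
      simp [demand, ih h.1, h.2.1]
  have hcount : ∀ (q : ℕ) (a : ExtJeep) (b : Bool), markCount (List.replicate q (a, b)) =
      if b then q else 0 := by
    intro q a b
    induction q with
    | zero => simp [markCount]
    | succ q ih => rw [List.replicate_succ, markCount_cons, ih]; cases b <;> simp
  have hround : ∀ (q : ℕ) (a : ExtJeep), a.kind = .round →
      markRound (List.replicate q (a, true)) = q := by
    intro q a ha
    induction q with
    | zero => simp [markRound]
    | succ q ih => rw [List.replicate_succ, markRound_cons, ih]; simp [ha]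
  have hexc : ∀ M : List (ExtJeep × Bool), (∀ a ∈ M.map Prod.fst, a.tank = 1) →
      (M.map excess).sum = 0 := by
    intro M hM
    refine List.sum_eq_zero fun x hx => ?_
    obtain ⟨z, hz, rfl⟩ := List.mem_map.1 hx
    have := hM z.1 (List.mem_map_of_mem hz)
    unfold excess
    split_ifs <;> simp [this]
  set M₀ : List (ExtJeep × Bool) := List.replicate n₁ (⟨.single, 1⟩, false) ++
    (List.replicate (min m n₂) (⟨.round, 1⟩, true) ++
      List.replicate (n₂ - min m n₂) (⟨.round, 1⟩, false)) with hM₀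
  have hfst : M₀.map Prod.fst = (ExtConvoy.initial B C d n₁ n₂ w).jeeps := by
    simp only [hM₀, ExtConvoy.initial, List.map_append, List.map_replicate,
      List.replicate_append_replicate]
    rw [Nat.add_sub_cancel' (min_le_right _ _)]
  have htank : ∀ a ∈ (ExtConvoy.initial B C d n₁ n₂ w).jeeps, a.tank = 1 := by
    intro a ha
    simp only [ExtConvoy.initial, List.mem_append, List.mem_replicate] at ha
    rcases ha with ⟨_, rfl⟩ | ⟨_, rfl⟩ <;> rfl
  have hlen : M₀.length = n₁ + n₂ := by
    rw [← List.length_map (f := Prod.fst) (as := M₀), hfst]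
    simp [ExtConvoy.initial]
  have hc₀ : markCount M₀ = min m n₂ := by
    have := hcount n₁ ⟨.single, 1⟩ false
    have := hcount (min m n₂) ⟨.round, 1⟩ true
    have := hcount (n₂ - min m n₂) ⟨.round, 1⟩ false
    simp only [markCount, hM₀, List.countP_append, if_true, Bool.false_eq_true, if_false] at *
    omega
  have hr₀ : min m n₂ ≤ markRound M₀ := by
    have := hround (min m n₂) ⟨.round, 1⟩ rfl
    simp only [markRound, hM₀, List.countP_append] at *
    omega
  obtain ⟨M, e1, e2, e3, _⟩ := exists_mark M₀ (min m M₀.length)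
    (by rw [hc₀, hlen]; omega) (min_le_right _ _)
  refine ⟨M, e1.trans hfst, ?_, fun _ => hr₀.trans e3, ?_⟩
  · rw [e2, ← List.length_map (f := Prod.fst) (as := M), e1, List.length_map]
  · rw [hexc M (by rw [e1, hfst]; exact htank)]
    simp only [ExtConvoy.initial]
    rw [hdem L hL]
    simp

lemma length_eq_of_map {M : List (ExtJeep × Bool)} {l : List ExtJeep}
    (h : M.map Prod.fst = l) : l.length = M.length := by rw [← h, List.length_map]

/-- The consumption of the marked jeeps. -/
noncomputable def markRate (M : List (ExtJeep × Bool)) : ℝ :=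
  (M.map fun z => if z.2 then z.1.kind.mult else 0).sum

/-- The number of marked single jeeps. -/
def markSingle (M : List (ExtJeep × Bool)) : ℕ :=
  M.countP fun z => z.2 && decide (z.1.kind = .single)

lemma markSingle_cons (z : ExtJeep × Bool) (M : List (ExtJeep × Bool)) :
    markSingle (z :: M) = markSingle M + if z.2 ∧ z.1.kind = .single then 1 else 0 := by
  simp [markSingle, List.countP_cons]

lemma markRate_cons (z : ExtJeep × Bool) (M : List (ExtJeep × Bool)) :
    markRate (z :: M) = (if z.2 then z.1.kind.mult else 0) + markRate M := by
  simp [markRate]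

lemma markRate_eq (M : List (ExtJeep × Bool)) :
    markRate M + markSingle M = 2 * markCount M := by
  induction M with
  | nil => simp [markRate, markSingle, markCount]
  | cons z M ih =>
    obtain ⟨⟨κ, t⟩, b⟩ := z
    rw [markSingle_cons, markCount_cons, markRate_cons]
    cases b <;> cases κ <;> simp [Kind.mult] <;> linarith

lemma markSingle_add_markRound_le (M : List (ExtJeep × Bool)) :
    markSingle M + markRound M ≤ markCount M := by
  induction M with
  | nil => simp [markRound, markSingle, markCount]
  | cons z M ih =>
    obtain ⟨⟨κ, t⟩, b⟩ := z
    rw [markSingle_cons, markCount_cons, markRound_cons]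
    cases b <;> cases κ <;> simp <;> omega

lemma markSingle_le (M : List (ExtJeep × Bool)) :
    markSingle M ≤ countKind .single (M.map Prod.fst) := by
  induction M with
  | nil => simp [markSingle, countKind]
  | cons z M ih =>
    obtain ⟨⟨κ, t⟩, b⟩ := z
    rw [markSingle_cons, List.map_cons, countKind_cons]
    cases b <;> cases κ <;> simp <;> omega

/-- The consumption of `min m k` jeeps, `z` of which are single, in a convoy of `k` jeeps. -/
lemma slope_le {n₁ n₂ m₁ m k k' z : ℕ} (hk : n₁ + n₂ ≤ k) (hkk : k ≤ k')
    (hz : z ≤ n₁ + m₁) (hz₀ : z ≤ min m k') (hz' : m₁ ≠ 0 → z + min m n₂ ≤ min m k') :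
    slope n₁ n₂ m₁ m k + z ≤ 2 * min m k' := by
  have h : m₁ = 0 ∨ z + min m n₂ ≤ min m k' := by
    by_cases h : m₁ = 0
    · exact Or.inl h
    · exact Or.inr (hz' h)
  unfold slope
  omega

lemma exists_ride_mark {h : ℝ} {M : List (ExtJeep × Bool)} {l : List ExtJeep}
    (hl : List.Forall₂ (fun a b => b.kind = a.kind ∧ 0 ≤ b.tank ∧ b.tank ≤ a.tank ∧
        a.tank - b.tank ≤ h * a.kind.mult) (M.map Prod.fst) l) :
    ∃ M' : List (ExtJeep × Bool), M'.map Prod.fst = l ∧ markCount M' = markCount M ∧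
      markRound M' = markRound M ∧
      (M'.map excess).sum + h * markRate M ≤ (M.map excess).sum +
        (h * totalRate (M.map Prod.fst) - (totalTank (M.map Prod.fst) - totalTank l)) := by
  induction M generalizing l with
  | nil =>
    rw [List.map_nil, List.forall₂_nil_left_iff] at hl
    subst hl
    exact ⟨[], rfl, rfl, rfl, by simp [markRate, totalRate, totalTank]⟩
  | cons z M ih =>
    obtain ⟨a, t⟩ := z
    rw [List.map_cons, List.forall₂_cons_left_iff] at hl
    obtain ⟨b, l, ⟨h1, h2, h3, h4⟩, hl, rfl⟩ := hl
    obtain ⟨M', e1, e2, e3, e4⟩ := ih hl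
    refine ⟨(b, t) :: M', by simp [e1], by simp [markCount_cons, e2],
      by simp [markRound_cons, e3, h1], ?_⟩
    rw [markRate_cons]
    simp only [totalRate, totalTank, List.map_cons, List.sum_cons, mul_add] at *
    cases t with
    | true => simp only [excess, if_true]; linarith
    | false =>
      simp only [excess, Bool.false_eq_true, if_false]
      have : max (b.tank - 1) 0 ≤ max (a.tank - 1) 0 := max_le_max (by linarith) le_rfl
      linarith

lemma MarkBound.ride {B : ℕ} {C d : ℝ} {n₁ n₂ m₁ : ℕ} {w : ℝ →₀ ℝ} {L : List ℝ} {c : ExtConvoy}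
    {m : ℕ} (hc : MarkBound B C d n₁ n₂ m₁ w L c m) {h : ℝ} (hh : 0 < h) {l : List ExtJeep}
    (hadm : Admissible n₁ n₂ m₁ c.jeeps)
    (hl : List.Forall₂ (fun a b => b.kind = a.kind ∧ 0 ≤ b.tank ∧ b.tank ≤ a.tank ∧
        a.tank - b.tank ≤ h * a.kind.mult) c.jeeps l)
    (hk : n₁ + n₂ + L.length ≤ c.jeeps.length) :
    MarkBound B C d n₁ n₂ m₁ w L
      { c with
          pos := c.pos - h
          jeeps := l
          cans := c.cans - (h * totalRate c.jeeps - (totalTank c.jeeps - totalTank l)) } m := by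
  obtain ⟨M, e1, e2, e3, e4⟩ := hc
  rw [← e1] at hl
  obtain ⟨M', f1, f2, f3, f4⟩ := exists_ride_mark hl
  have hlen : M'.length = M.length := by
    rw [← length_eq_of_map f1, ← hl.length_eq, List.length_map]
  refine ⟨M', f1, by rw [f2, e2, hlen], ?_, ?_⟩
  · rw [f3]
    dsimp only
    rw [countKind_forall₂ (fun a b h => h.1) hl, e1]
    exact e3
  · have hdem := demand_sub_le (d := d) (n := n₁ + n₂) (L := L) (x := c.pos)
      (f := fun k => (slope n₁ n₂ m₁ m k : ℝ)) (h := h) (c := markRate M) (fun k h1 h2 => by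
        have h5 : slope n₁ n₂ m₁ m k + markSingle M ≤ 2 * min m M.length := by
          rw [length_eq_of_map e1] at hk
          have h6 := markSingle_add_markRound_le M
          refine slope_le h1 (h2.trans hk) ((markSingle_le M).trans (e1 ▸ hadm.1)) (by omega)
            fun hm => ?_
          have := e3 (hadm.2.2.2 hm)
          omega
        have h6 := markRate_eq M
        rw [e2] at h6
        have h7 : ((slope n₁ n₂ m₁ m k + markSingle M : ℕ) : ℝ) ≤ (2 * min m M.length : ℕ) :=
          Nat.cast_le.2 h5
        push_cast at *
        linarith) hh.le
    rw [e1] at f4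
    have hll : l.length = c.jeeps.length := by
      rw [← hl.length_eq, e1]
    simp only [hll]
    linarith

lemma MarkBound.add {B : ℕ} {C d : ℝ} {n₁ n₂ m₁ : ℕ} {w : ℝ →₀ ℝ} {L : List ℝ} {c : ExtConvoy}
    {m : ℕ} (hc : MarkBound B C d n₁ n₂ m₁ w L c m) {κ : Kind} (hκ : κ ≠ .round) :
    MarkBound B C d n₁ n₂ m₁ w L
      { c with jeeps := ⟨κ, 1⟩ :: c.jeeps, cans := c.cans + B * C } m := by
  obtain ⟨M, e1, e2, e3, e4⟩ := hc
  refine ⟨(⟨κ, 1⟩, decide (M.length < m)) :: M, by simp [e1], ?_, ?_, ?_⟩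
  · rw [markCount_cons, e2, List.length_cons]; simp; split_ifs <;> omega
  · rw [markRound_cons]
    simp only [countKind_cons, hκ, and_false, if_false, add_zero]
    exact e3
  · have : excess (⟨κ, 1⟩, decide (M.length < m)) = 0 := by unfold excess; split_ifs <;> simp
    rw [List.map_cons, List.sum_cons, this]
    dsimp only
    rw [List.length_cons]
    push_cast
    linarith

lemma MarkBound.replace {B : ℕ} {C d : ℝ} {n₁ n₂ m₁ : ℕ} {w : ℝ →₀ ℝ} {L : List ℝ}
    {c : ExtConvoy} {m : ℕ} (hc : MarkBound B C d n₁ n₂ m₁ w L c m) {a : ExtJeep}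
    {l : List ExtJeep} (hl : c.jeeps = a :: l) (hr : countKind .round c.jeeps ≤ n₂) :
    MarkBound B C d n₁ n₂ m₁ w L { c with jeeps := ⟨.single, a.tank⟩ :: l } m := by
  obtain ⟨M, e1, e2, e3, e4⟩ := hc
  obtain ⟨⟨a, t⟩, M, rfl, rfl, rfl⟩ := List.map_eq_cons_iff.1 (e1.trans hl)
  refine ⟨(⟨.single, a.tank⟩, t) :: M, rfl, ?_, ?_, ?_⟩
  · rw [markCount_cons] at *; simpa using e2
  · rw [hl, countKind_cons] at hr e3
    rw [markRound_cons] at *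
    simp only [countKind_cons]
    simp
    intro h
    by_cases ha : a.kind = .round
    · simp [ha] at hr; omega
    · simpa [ha] using e3 (by omega)
  · rw [hl] at e4
    simpa [excess] using e4

lemma MarkBound.refuel {B : ℕ} {C d : ℝ} {n₁ n₂ m₁ : ℕ} {w : ℝ →₀ ℝ} {L : List ℝ}
    {c : ExtConvoy} {m : ℕ} (hc : MarkBound B C d n₁ n₂ m₁ w L c m) {a : ExtJeep}
    {l : List ExtJeep} (hl : c.jeeps = a :: l) {q : ℝ} (hq : 0 ≤ q) :
    MarkBound B C d n₁ n₂ m₁ w L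
      { c with jeeps := ⟨a.kind, a.tank + q⟩ :: l, cans := c.cans - q } m := by
  obtain ⟨M, e1, e2, e3, e4⟩ := hc
  obtain ⟨⟨a, t⟩, M, rfl, rfl, rfl⟩ := List.map_eq_cons_iff.1 (e1.trans hl)
  refine ⟨(⟨a.kind, a.tank + q⟩, t) :: M, rfl, ?_, ?_, ?_⟩
  · rw [markCount_cons] at *; simpa using e2
  · rw [hl, countKind_cons] at e3
    rw [markRound_cons] at *
    simpa [countKind_cons] using e3
  · rw [hl] at e4
    have : excess (⟨a.kind, a.tank + q⟩, t) ≤ excess (a, t) + q := by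
      unfold excess
      cases t
      · simp only [Bool.false_eq_true, if_false]
        rcases max_cases (a.tank + q - 1) 0 with h | h <;>
        rcases max_cases (a.tank - 1) 0 with h' | h' <;> linarith
      · simp only [if_true]; linarith
    simp only [List.map_cons, List.sum_cons, List.length_cons] at *
    linarith

lemma MarkBound.merge {B : ℕ} {C d : ℝ} {n₁ n₂ m₁ : ℕ} {w : ℝ →₀ ℝ} {L : List ℝ}
    {c : ExtConvoy} {m : ℕ} (hc : MarkBound B C d n₁ n₂ m₁ w L c m) {a b : ExtJeep}
    {l : List ExtJeep} (hl : c.jeeps = a :: b :: l) (hr : countKind .round c.jeeps ≤ n₂)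
    {κ : Kind} (hκ : a.kind ≠ .round → b.kind ≠ .round → κ ≠ .round) :
    MarkBound B C d n₁ n₂ m₁ w L
      { c with jeeps := ⟨κ, a.tank + b.tank - 1⟩ :: l, cans := c.cans - B * C } m := by
  obtain ⟨M, e1, e2, e3, e4⟩ := hc
  obtain ⟨⟨a, s⟩, M, rfl, rfl, h⟩ := List.map_eq_cons_iff.1 (e1.trans hl)
  obtain ⟨⟨b, t⟩, M, rfl, rfl, rfl⟩ := List.map_eq_cons_iff.1 h
  dsimp only at *
  have hM := markCount_le M
  have hcount : markCount ((⟨κ, a.tank + b.tank - 1⟩, s || t) :: M) ≤ min m (M.length + 1) := by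
    simp only [markCount_cons, List.length_cons] at *
    cases s <;> cases t <;> simp at * <;> omega
  obtain ⟨M', f1, f2, f3, f4⟩ := exists_mark _ _ hcount (by simp)
  refine ⟨M', by simpa using f1, ?_, ?_, ?_⟩
  · rw [f2, ← List.length_map (f := Prod.fst) (as := M'), f1]; simp
  · intro h
    refine le_trans ?_ f3
    rw [hl] at hr e3
    simp only [markRound_cons, countKind_cons] at *
    by_cases ha : a.kind = .round <;> by_cases hb : b.kind = .round <;>
      by_cases hk : κ = .round <;> simp [ha, hb, hk] at * <;>
      cases s <;> cases t <;> simp at * <;> omega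
  · have : excess (⟨κ, a.tank + b.tank - 1⟩, s || t) ≤ excess (a, s) + excess (b, t) := by
      unfold excess
      cases s <;> cases t <;> simp
      · rcases max_cases (a.tank - 1) 0 with h | h <;>
        rcases max_cases (b.tank - 1) 0 with h' | h' <;> constructor <;> linarith
      · linarith [le_max_left (a.tank - 1) 0]
      · linarith [le_max_left (b.tank - 1) 0]
      · linarith
    rw [hl] at e4
    simp only [List.map_cons, List.sum_cons, List.length_cons] at *
    push_cast at *
    linarith

lemma MarkBound.length_lt {B : ℕ} {C d : ℝ} {n₁ n₂ m₁ : ℕ} {w : ℝ →₀ ℝ} {L : List ℝ} {a : ℝ}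
    {c : ExtConvoy} (hB : 0 < B) (hC : 0 < C) (hw : ∀ p, 0 ≤ w p)
    (hL : Certified B C d n₁ n₂ m₁ w (a :: L)) (hc : c.Proper d n₂ w)
    (h : ∀ m, MarkBound B C d n₁ n₂ m₁ w L c m) (h0 : 0 ≤ c.pos) (ha : c.pos < a) :
    n₁ + n₂ + L.length < c.jeeps.length := by
  obtain ⟨m, hm⟩ := hL.2.2
  obtain ⟨M, e1, e2, e3, e4⟩ := h m
  have h1 := hm c.pos h0 ha
  have h2 := hc.weightBeyond_le hw
  have h3 := hc.cans_nonneg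
  have h4 : ∀ M : List (ExtJeep × Bool), (∀ a ∈ M.map Prod.fst, 0 ≤ a.tank) →
      -(markCount M : ℝ) ≤ (M.map excess).sum := by
    intro M
    induction M with
    | nil => simp [markCount]
    | cons z M ih =>
      intro h
      have h5 := ih fun a ha => h a (by simp at ha ⊢; tauto)
      have h6 := h z.1 (by simp)
      have h7 : -(if z.2 then 1 else 0 : ℝ) ≤ excess z := by
        unfold excess
        split_ifs
        · linarith
        · simp
      rw [markCount_cons, List.map_cons, List.sum_cons]
      push_cast
      linarith
  have h5 := h4 M (e1 ▸ hc.tank_nonneg)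
  have h6 : (markCount M : ℝ) ≤ m := by rw [e2]; exact Nat.cast_le.2 (min_le_left _ _)
  have hBC : 0 < B * C := by positivity
  have h7 : ((n₁ + n₂ + L.length : ℕ) : ℝ) * (B * C) < c.jeeps.length * (B * C) := by linarith
  exact Nat.cast_lt.1 (lt_of_mul_lt_mul_right h7 hBC.le)

lemma ExtConvoy.reachable_nonneg {B : ℕ} {C d : ℝ} {n₁ n₂ m₁ : ℕ} {w : ℝ →₀ ℝ} {c : ExtConvoy}
    (hd : 0 < d)
    (h : Relation.ReflTransGen (ExtStep B C n₁ n₂ m₁) (ExtConvoy.initial B C d n₁ n₂ w) c) :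
    0 ≤ c.pos := by
  induction h with
  | refl => exact hd.le
  | tail _ hs ih => cases hs <;> simp_all

lemma ExtConvoy.reachable_proper {B : ℕ} {C d : ℝ} {n₁ n₂ m₁ : ℕ} {w : ℝ →₀ ℝ} {c : ExtConvoy}
    (hC : 0 < C) (hpos : ∀ p, w p ≠ 0 → 0 < p ∧ p ≤ d)
    (h : Relation.ReflTransGen (ExtStep B C n₁ n₂ m₁) (ExtConvoy.initial B C d n₁ n₂ w) c) :
    c.Proper d n₂ w := by
  induction h with
  | refl => exact proper_initial hC hpos
  | tail _ hs ih => exact ih.step hC hs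

lemma MarkBound.step {B : ℕ} {C d : ℝ} {n₁ n₂ m₁ : ℕ} {w : ℝ →₀ ℝ} {L : List ℝ}
    {c c' : ExtConvoy} {m : ℕ} (hs : ExtStep B C n₁ n₂ m₁ c c')
    (hr : countKind .round c.jeeps ≤ n₂)
    (hk : c'.pos ≠ c.pos → Admissible n₁ n₂ m₁ c.jeeps → c'.jeeps.length = c.jeeps.length →
      n₁ + n₂ + L.length ≤ c.jeeps.length ∨ MarkBound B C d n₁ n₂ m₁ w L c' m)
    (hc : MarkBound B C d n₁ n₂ m₁ w L c m) : MarkBound B C d n₁ n₂ m₁ w L c' m := by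
  cases hs with
  | ride h l hh hpos hdepot hadm hl hcans =>
    rcases hk (by simp; exact hh.ne') hadm hl.length_eq.symm with h1 | h1
    · exact hc.ride hh hadm hl h1
    · exact h1
  | fillDepot hdepot hcans =>
    obtain ⟨M, e1, e2, e3, e4⟩ := hc
    refine ⟨M, e1, e2, e3, ?_⟩
    rw [sum_erase_eq c.todo c.pos] at e4
    dsimp only
    linarith
  | add κ hκ => exact hc.add hκ
  | replace a l hl ha => exact hc.replace hl hr
  | refuel a l q hl hq hcans ha => exact hc.refuel hl hq
  | mergeSingle a b l hl ha hb h1 h2 hcans =>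
    exact hc.merge hl hr (by simp)
  | mergeDouble a b l hl ha hb h1 h2 hcans =>
    refine hc.merge hl hr (fun h h' => ?_)
    rw [if_neg h]
    exact h'
  | perm l hl =>
    obtain ⟨M, e1, e2, e3, e4⟩ := hc
    obtain ⟨M', f1, f2⟩ := exists_perm_map_eq Prod.fst hl M e1
    refine ⟨M', f2, ?_, ?_, ?_⟩
    · rw [← f1.length_eq, ← e2]; exact (f1.countP_eq _).symm
    · have h1 : markRound M' = markRound M := (f1.countP_eq _).symm
      have h2 : countKind .round l = countKind .round c.jeeps := (hl.map _).count_eq _ |>.symm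
      rw [h1, h2]; exact e3
    · rw [← (f1.map excess).sum_eq, ← hl.length_eq]
      exact e4

lemma ExtConvoy.reachable_markBound {B : ℕ} {C d : ℝ} {n₁ n₂ m₁ : ℕ} {w : ℝ →₀ ℝ}
    (hB : 0 < B) (hC : 0 < C) (hd : 0 < d) (hw : ∀ p, 0 ≤ w p)
    (hpos : ∀ p, w p ≠ 0 → 0 < p ∧ p ≤ d) {L : List ℝ} (hL : Certified B C d n₁ n₂ m₁ w L)
    {c : ExtConvoy}
    (h : Relation.ReflTransGen (ExtStep B C n₁ n₂ m₁) (ExtConvoy.initial B C d n₁ n₂ w) c)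
    (m : ℕ) : MarkBound B C d n₁ n₂ m₁ w L c m := by
  induction L generalizing c m with
  | nil =>
    induction h with
    | refl => exact .initial hL m
    | tail hr hs ih =>
      exact ih.step hs (reachable_proper hC hpos hr).round_le fun _ hadm _ => .inl hadm.2.1
  | cons a L ihL =>
    induction h with
    | refl => exact .initial hL m
    | @tail c c' hr hs ih =>
      refine ih.step hs (reachable_proper hC hpos hr).round_le fun _ _ hlen => ?_
      have hr' := hr.tail hs
      rcases lt_or_ge c'.pos a with ha | ha
      · left
        have := MarkBound.length_lt hB hC hw hL (reachable_proper hC hpos hr')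
          (fun m => ihL hL.1 hr' m) (reachable_nonneg hd hr') ha
        rw [List.length_cons]
        omega
      · right
        obtain ⟨M, e1, e2, e3, e4⟩ := ihL hL.1 hr' m
        refine ⟨M, e1, e2, e3, ?_⟩
        simpa [demand, ha] using e4

/-- The demand is a lower bound for extended backward convoy algorithms. -/
lemma ExtendedResult.le {B : ℕ} {C d : ℝ} {n₁ n₂ m₁ : ℕ} {w : ℝ →₀ ℝ}
    (hB : 0 < B) (hC : 0 < C) (hd : 0 < d) (hw : ∀ p, 0 ≤ w p)
    (hpos : ∀ p, w p ≠ 0 → 0 < p ∧ p ≤ d) {L : List ℝ} (hL : Certified B C d n₁ n₂ m₁ w L)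
    {r : ℝ} (h : ExtendedResult B C d n₁ n₂ m₁ w r) :
    ∃ k, ∀ m, k ≤ m →
      demand d (n₁ + n₂) (fun k => slope n₁ n₂ m₁ m k) L 0 + (w.sum fun _ q => q) ≤ r := by
  obtain ⟨c, hr, h0, rfl⟩ := h
  refine ⟨c.jeeps.length, fun m hm => ?_⟩
  obtain ⟨M, e1, e2, e3, e4⟩ := ExtConvoy.reachable_markBound hB hC hd hw hpos hL hr m
  have hp := ExtConvoy.reachable_proper hC hpos hr
  have htodo : c.todo = 0 := by
    ext p
    by_contra h
    rcases hp.todo_eq p with h1 | h1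
    · exact h (hp.todo_eq_zero p (by rw [h0]; exact (hpos p (h1 ▸ h)).1))
    · exact h h1
  have h1 : ∀ M : List (ExtJeep × Bool),
      totalTank (M.map Prod.fst) - M.length ≤ (M.map excess).sum := by
    intro M
    induction M with
    | nil => simp [totalTank]
    | cons z M ih =>
      have := sub_one_le_excess z
      simp only [totalTank, List.map_cons, List.sum_cons, List.length_cons] at *
      push_cast
      linarith
  have h2 := h1 M
  rw [e1, ← length_eq_of_map e1] at h2
  rw [h0, htodo, Finsupp.sum_zero_index] at e4
  linarith

/-! ### Excursions of a path -/

/-- The number of steps of the path `p` from `≤ x` to `> x` until time `t`. -/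
noncomputable def exits (p : ℕ → ℝ) (x : ℝ) (t : ℕ) : ℕ :=
  ((Finset.range t).filter fun s => p s ≤ x ∧ x < p (s + 1)).card

/-- The number of steps of the path `p` from `> x` to `≤ x` until time `t`. -/
noncomputable def returns (p : ℕ → ℝ) (x : ℝ) (t : ℕ) : ℕ :=
  ((Finset.range t).filter fun s => p (s + 1) ≤ x ∧ x < p s).card

/-- The steps of the `i`th excursion beyond `x`, including possible steps between its end and the
next excursion. -/
noncomputable def excursion (p : ℕ → ℝ) (x : ℝ) (T i : ℕ) : Finset ℕ :=
  (Finset.range T).filter fun s => exits p x (s + 1) = i + 1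

/-- The farthest position of the `i`th excursion beyond `x`. -/
noncomputable def depth (p : ℕ → ℝ) (x : ℝ) (T i : ℕ) : ℝ :=
  (excursion p x T i).fold max x fun s => max (p s) (p (s + 1))

/-- The step `s` of the path `p` passes `y`. -/
def Passes (p : ℕ → ℝ) (y : ℝ) (s : ℕ) : Prop :=
  p s ≤ y ∧ y < p (s + 1) ∨ p (s + 1) ≤ y ∧ y < p s

noncomputable instance (p : ℕ → ℝ) (y : ℝ) : DecidablePred (Passes p y) :=
  fun _ => by unfold Passes; infer_instance

/-- The number of times that `y` is passed during the `i`th excursion beyond `x`. -/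
noncomputable def passCount (p : ℕ → ℝ) (x : ℝ) (T i : ℕ) (y : ℝ) : ℕ :=
  ((excursion p x T i).filter (Passes p y)).card

/-- The length of the `i`th excursion beyond `x`. -/
noncomputable def excursionLength (p : ℕ → ℝ) (x : ℝ) (T i : ℕ) : ℝ :=
  ∑ s ∈ excursion p x T i, |max (p (s + 1)) x - max (p s) x|

lemma exists_switch {P : ℕ → Prop} {a b : ℕ} (hab : a ≤ b) (ha : ¬ P a) (hb : P b) :
    ∃ s, a ≤ s ∧ s < b ∧ ¬ P s ∧ P (s + 1) := by
  induction b, hab using Nat.le_induction with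
  | base => exact absurd hb ha
  | succ b hab ih =>
    by_cases h : P b
    · obtain ⟨s, h1, h2, h3⟩ := ih h
      exact ⟨s, h1, by omega, h3⟩
    · exact ⟨b, hab, by omega, h, hb⟩

section Path

variable {p : ℕ → ℝ} {x y d : ℝ} {t s T i : ℕ}

lemma exits_zero : exits p x 0 = 0 := by simp [exits]

lemma returns_zero : returns p x 0 = 0 := by simp [returns]

lemma exits_succ : exits p x (t + 1) = exits p x t + if p t ≤ x ∧ x < p (t + 1) then 1 else 0 := by
  unfold exits
  rw [Finset.range_add_one, Finset.filter_insert]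
  split_ifs
  · rw [Finset.card_insert_of_notMem (by simp)]
  · rfl

lemma returns_succ :
    returns p x (t + 1) = returns p x t + if p (t + 1) ≤ x ∧ x < p t then 1 else 0 := by
  unfold returns
  rw [Finset.range_add_one, Finset.filter_insert]
  split_ifs
  · rw [Finset.card_insert_of_notMem (by simp)]
  · rfl

lemma exits_mono : Monotone (exits p x) :=
  monotone_nat_of_le_succ fun t => by rw [exits_succ]; omega

lemma returns_mono : Monotone (returns p x) :=
  monotone_nat_of_le_succ fun t => by rw [returns_succ]; omega

lemma exits_eq (h0 : p 0 ≤ x) (t : ℕ) :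
    exits p x t = returns p x t + if x < p t then 1 else 0 := by
  induction t with
  | zero => simp [exits_zero, returns_zero, h0]
  | succ t ih =>
    rw [exits_succ, returns_succ, ih]
    by_cases h1 : x < p t <;> by_cases h2 : x < p (t + 1) <;> simp [h1, h2, not_lt.1, not_le.2]

lemma exits_pos (h0 : p 0 ≤ x) (ht : x < p t) : 1 ≤ exits p x t := by
  rw [exits_eq h0, if_pos ht]; omega

/-- The step at which the `i`th excursion starts. -/
lemma exists_exit (hi : i < exits p x T) :
    ∃ s < T, p s ≤ x ∧ x < p (s + 1) ∧ exits p x s = i ∧ exits p x (s + 1) = i + 1 := by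
  obtain ⟨s, _, h1, h2, h3⟩ := exists_switch (P := fun t => i < exits p x t) (Nat.zero_le T)
    (by simp [exits_zero]) hi
  have h4 := exits_succ (p := p) (x := x) (t := s)
  by_cases h : p s ≤ x ∧ x < p (s + 1)
  · rw [if_pos h] at h4
    exact ⟨s, h1, h.1, h.2, by omega, by omega⟩
  · rw [if_neg h] at h4; omega

lemma exists_return (h0 : p 0 ≤ x) (hi : i < returns p x T) :
    ∃ s < T, p (s + 1) ≤ x ∧ x < p s ∧ returns p x (s + 1) = i + 1 ∧ exits p x (s + 1) = i + 1 := by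
  obtain ⟨s, _, h1, h2, h3⟩ := exists_switch (P := fun t => i < returns p x t) (Nat.zero_le T)
    (by simp [returns_zero]) hi
  have h4 := exits_eq h0 (s + 1)
  have h5 := returns_succ (p := p) (x := x) (t := s)
  by_cases h : p (s + 1) ≤ x ∧ x < p s
  · rw [if_pos h] at h5
    rw [if_neg (not_lt.2 h.1)] at h4
    exact ⟨s, h1, h.1, h.2, by omega, by omega⟩
  · rw [if_neg h] at h5; omega

lemma lt_depth_iff (hxy : x ≤ y) :
    y < depth p x T i ↔ ∃ s ∈ excursion p x T i, y < p s ∨ y < p (s + 1) := by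
  unfold depth
  rw [Finset.lt_fold_max]
  simp [hxy.not_gt]

lemma le_depth (hs : s ∈ excursion p x T i) : p (s + 1) ≤ depth p x T i := by
  unfold depth
  rw [Finset.le_fold_max]
  exact Or.inr ⟨s, hs, le_max_right _ _⟩

lemma depth_le (hx : x ≤ d) (hp : ∀ t ≤ T, p t ≤ d) : depth p x T i ≤ d := by
  unfold depth
  rw [Finset.fold_max_le]
  refine ⟨hx, fun s hs => ?_⟩
  have := Finset.mem_range.1 (Finset.mem_filter.1 hs).1
  exact max_le (hp _ this.le) (hp _ this)

lemma passCount_eq_zero (hxy : x ≤ y) (h : depth p x T i ≤ y) : passCount p x T i y = 0 := by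
  unfold passCount
  rw [Finset.card_eq_zero, Finset.filter_eq_empty_iff]
  intro s hs hps
  refine h.not_gt ((lt_depth_iff hxy).2 ⟨s, hs, ?_⟩)
  rcases hps with h | h
  · exact Or.inr h.2
  · exact Or.inl h.2

/-- An excursion that gets beyond `y` passes `y` once, and twice if it ends. -/
lemma le_passCount (h0 : p 0 ≤ x) (hxy : x ≤ y) (hi : i < exits p x T)
    (h : y < depth p x T i) : (if i < returns p x T then 2 else 1) ≤ passCount p x T i y := by
  obtain ⟨s₀, hs₀, hps, hps', he, he'⟩ := exists_exit hi
  obtain ⟨s, hs, hy⟩ := (lt_depth_iff hxy).1 h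
  rw [excursion, Finset.mem_filter, Finset.mem_range] at hs
  obtain ⟨τ, hsτ, hτ, hyτ⟩ : ∃ τ, s ≤ τ ∧ τ ≤ s + 1 ∧ y < p τ := by
    rcases hy with h | h
    · exact ⟨s, le_rfl, by omega, h⟩
    · exact ⟨s + 1, by omega, le_rfl, h⟩
  have heτ : exits p x τ ≤ i + 1 := hs.2 ▸ exits_mono hτ
  have hs₀s : s₀ < s + 1 := by
    by_contra hcon
    have := exits_mono (p := p) (x := x) (not_lt.1 hcon)
    omega
  have hne : s₀ ≠ τ := by
    rintro rfl
    linarith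
  have heτ' : i + 1 ≤ exits p x τ := he' ▸ exits_mono (show s₀ + 1 ≤ τ by omega)
  obtain ⟨u, hu1, hu2, hu3, hu4⟩ := exists_switch (P := fun t => y < p t) (show s₀ ≤ τ by omega)
    (not_lt.2 (hps.trans hxy)) hyτ
  have hu : u ∈ (excursion p x T i).filter (Passes p y) := by
    rw [excursion, Finset.mem_filter, Finset.mem_filter, Finset.mem_range]
    refine ⟨⟨by omega, le_antisymm ?_ ?_⟩, Or.inl ⟨not_lt.1 hu3, hu4⟩⟩
    · exact (exits_mono (show u + 1 ≤ τ by omega)).trans heτ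
    · exact he' ▸ exits_mono (show s₀ + 1 ≤ u + 1 by omega)
  unfold passCount
  split_ifs with hret
  · obtain ⟨s₁, hs₁, hr1, hr2, hr3, hr4⟩ := exists_return h0 hret
    have hτs₁ : τ ≤ s₁ := by
      by_contra hcon
      have h1 := exits_eq h0 τ
      rw [if_pos (hxy.trans_lt hyτ)] at h1
      have := returns_mono (p := p) (x := x) (show s₁ + 1 ≤ τ by omega)
      omega
    obtain ⟨v, hv1, hv2, hv3, hv4⟩ := exists_switch (P := fun t => p t ≤ y)
      (show τ ≤ s₁ + 1 by omega) (not_le.2 hyτ) (hr1.trans hxy)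
    have hv : v ∈ (excursion p x T i).filter (Passes p y) := by
      rw [excursion, Finset.mem_filter, Finset.mem_filter, Finset.mem_range]
      refine ⟨⟨by omega, le_antisymm ?_ ?_⟩, Or.inr ⟨hv4, not_le.1 hv3⟩⟩
      · exact hr4 ▸ exits_mono (show v + 1 ≤ s₁ + 1 by omega)
      · exact heτ'.trans (exits_mono (show τ ≤ v + 1 by omega))
    refine Finset.one_lt_card.2 ⟨u, hu, v, hv, ?_⟩
    rintro rfl
    exact hu3 (not_le.1 hv3)
  · exact Finset.card_pos.2 ⟨u, hu⟩

/-- All passings of `y` belong to excursions beyond `x`. -/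
lemma sum_passCount (h0 : p 0 ≤ x) (hxy : x ≤ y) :
    ∑ i ∈ Finset.range (exits p x T), passCount p x T i y = exits p y T + returns p y T := by
  have h1 : ((Finset.range T).filter (Passes p y)).card = exits p y T + returns p y T := by
    unfold exits returns
    rw [← Finset.card_union_of_disjoint, ← Finset.filter_or]
    · rfl
    · rw [Finset.disjoint_filter]
      rintro s _ ⟨h1, h2⟩ ⟨h3, h4⟩
      linarith
  rw [← h1, Finset.card_eq_sum_card_fiberwise (f := fun s => exits p x (s + 1) - 1)
    (t := Finset.range (exits p x T))]
  · refine Finset.sum_congr rfl fun i _ => ?_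
    unfold passCount excursion
    congr 1
    ext s
    simp only [Finset.mem_filter, Finset.mem_range]
    refine ⟨fun ⟨⟨h2, h3⟩, h4⟩ => ⟨⟨h2, h4⟩, by omega⟩, fun ⟨⟨h2, h3⟩, h4⟩ => ⟨⟨h2, ?_⟩, h3⟩⟩
    have : 1 ≤ exits p x (s + 1) := by
      rcases h3 with h | h
      · exact exits_pos h0 (hxy.trans_lt h.2)
      · exact (exits_pos h0 (hxy.trans_lt h.2)).trans (exits_mono (Nat.le_succ s))
    omega
  · intro s hs
    simp only [Finset.coe_filter, Set.mem_ofPred_eq, Finset.mem_range, Finset.coe_range,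
      Set.mem_Iio] at hs ⊢
    have h2 : exits p x (s + 1) ≤ exits p x T := exits_mono hs.1
    have : 1 ≤ exits p x (s + 1) := by
      rcases hs.2 with h | h
      · exact exits_pos h0 (hxy.trans_lt h.2)
      · exact (exits_pos h0 (hxy.trans_lt h.2)).trans (exits_mono (Nat.le_succ s))
    omega

/-- At most one excursion does not end. -/
lemma card_not_returns (h0 : p 0 ≤ x) :
    ((Finset.range (exits p x T)).filter fun i => ¬ i < returns p x T).card =
      if x < p T then 1 else 0 := by
  have h1 := exits_eq h0 T
  have h2 : (Finset.range (exits p x T)).filter (fun i => ¬ i < returns p x T) =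
      Finset.Ico (returns p x T) (exits p x T) := by
    ext i; simp; omega
  rw [h2, Nat.card_Ico]
  omega

lemma exits_lt_of_le_of_lt (hst : s ≤ t) (hs : p s ≤ x) (ht : x < p t) :
    exits p x s < exits p x t := by
  obtain ⟨u, hu1, hu2, hu3, hu4⟩ := exists_switch (P := fun t => x < p t) hst (not_lt.2 hs) ht
  have h1 := exits_mono (p := p) (x := x) hu1
  have h2 := exits_mono (p := p) (x := x) (show u + 1 ≤ t by omega)
  rw [exits_succ, if_pos ⟨not_lt.1 hu3, hu4⟩] at h2
  omega

lemma crossings_outward_le (hx : 0 ≤ x) (hxd : x < d) : crossings p T 0 d ≤ exits p x T := by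
  rw [crossings, ← Finset.card_range (exits p x T), ← Set.ncard_coe_finset]
  refine Set.ncard_le_ncard_of_injOn (fun q => exits p x q.2 - 1) ?_ ?_ (Finset.finite_toSet _)
  · rintro ⟨t₁, t₂⟩ ⟨h1, h2, h3, h4, h5⟩
    dsimp only at *
    have h6 := exits_lt_of_le_of_lt (p := p) (x := x) h1.le (by rwa [h3]) (by rwa [h4])
    have := exits_mono (p := p) (x := x) h2
    simp only [Finset.coe_range, Set.mem_Iio]
    omega
  · have key : ∀ t₁ t₂ t₁' t₂', t₁ < t₂ → p t₁ = 0 → p t₂ = d → t₁' < t₂' → p t₁' = 0 →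
        p t₂' = d → (∀ t, t₁' < t → t < t₂' → p t ≠ 0 ∧ p t ≠ d) →
        exits p x t₂ - 1 = exits p x t₂' - 1 → t₂' ≤ t₂ := by
      intro t₁ t₂ t₁' t₂' h1 h2 h3 h4 h5 h6 h7 h8
      by_contra h9
      rcases le_or_gt t₂ t₁' with h10 | h10
      · have a1 := exits_lt_of_le_of_lt (p := p) (x := x) h4.le (by rwa [h5]) (by rwa [h6])
        have a2 := exits_lt_of_le_of_lt (p := p) (x := x) h1.le (by rwa [h2]) (by rwa [h3])
        have a3 := exits_mono (p := p) (x := x) h10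
        omega
      · exact (h7 t₂ h10 (by omega)).2 h3
    rintro ⟨t₁, t₂⟩ ⟨h1, h2, h3, h4, h5⟩ ⟨t₁', t₂'⟩ ⟨h1', h2', h3', h4', h5'⟩ h
    dsimp only at *
    obtain rfl : t₂ = t₂' := le_antisymm (key _ _ _ _ h1' h3' h4' h1 h3 h4 h5 h.symm)
      (key _ _ _ _ h1 h3 h4 h1' h3' h4' h5' h)
    rw [Prod.mk.injEq]
    refine ⟨?_, rfl⟩
    rcases lt_trichotomy t₁ t₁' with h6 | h6 | h6
    · exact absurd h3' (h5 t₁' h6 h1').1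
    · exact h6
    · exact absurd h3 (h5' t₁ h6 h1).1

/-- Rides back from `d` yield different excursions beyond `x` that reach `d` and end. -/
lemma crossings_back_le (hx : 0 ≤ x) (hxd : x < d) (h0 : p 0 = 0) :
    crossings p T d 0 ≤ ((Finset.range (exits p x T)).filter fun i =>
      i < returns p x T ∧ d ≤ depth p x T i).card := by
  have h0x : p 0 ≤ x := by rwa [h0]
  rw [crossings, ← Set.ncard_coe_finset]
  refine Set.ncard_le_ncard_of_injOn (fun q => exits p x q.1 - 1) ?_ ?_ (Finset.finite_toSet _)
  · rintro ⟨t₁, t₂⟩ ⟨h1, h2, h3, h4, h5⟩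
    dsimp only at *
    have a1 := exits_mono (p := p) (x := x) h1.le
    have a2 := exits_eq h0x t₂
    rw [if_neg (by rw [h4]; exact not_lt.2 hx)] at a2
    have a3 := exits_mono (p := p) (x := x) h2
    have a4 := returns_mono (p := p) (x := x) h2
    have a5 := exits_pos h0x (show x < p t₁ by rwa [h3])
    simp only [Finset.coe_filter, Finset.mem_range, Set.mem_ofPred_eq]
    refine ⟨by omega, by omega, ?_⟩
    obtain ⟨s, rfl⟩ : ∃ s, t₁ = s + 1 := by
      refine ⟨t₁ - 1, ?_⟩
      have : t₁ ≠ 0 := by rintro rfl; linarith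
      omega
    rw [← h3]
    refine le_depth ?_
    rw [excursion, Finset.mem_filter, Finset.mem_range]
    omega
  · have key : ∀ t₁ t₂ t₁' t₂', t₁ < t₂ → p t₁ = d → p t₂ = 0 → t₁' < t₂' → p t₁' = d →
        p t₂' = 0 → (∀ t, t₁ < t → t < t₂ → p t ≠ d ∧ p t ≠ 0) →
        exits p x t₁ - 1 = exits p x t₁' - 1 → t₁' ≤ t₁ := by
      intro t₁ t₂ t₁' t₂' h1 h2 h3 h4 h5 h6 h7 h8
      by_contra h9
      rcases le_or_gt t₂ t₁' with h10 | h10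
      · have a1 := exits_lt_of_le_of_lt (p := p) (x := x) h10 (by rwa [h3]) (by rwa [h5])
        have a2 := exits_mono (p := p) (x := x) h1.le
        have a5 := exits_pos h0x (show x < p t₁ by rwa [h2])
        omega
      · exact (h7 t₁' (by omega) h10).1 h5
    rintro ⟨t₁, t₂⟩ ⟨h1, h2, h3, h4, h5⟩ ⟨t₁', t₂'⟩ ⟨h1', h2', h3', h4', h5'⟩ h
    dsimp only at *
    obtain rfl : t₁ = t₁' := le_antisymm (key _ _ _ _ h1' h3' h4' h1 h3 h4 h5' h.symm)
      (key _ _ _ _ h1 h3 h4 h1' h3' h4' h5 h)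
    rw [Prod.mk.injEq]
    refine ⟨rfl, ?_⟩
    rcases lt_trichotomy t₂ t₂' with h6 | h6 | h6
    · exact absurd h4 (h5' t₂ h1 h6).2
    · exact h6
    · exact absurd h4' (h5 t₂' h1' h6).2

open MeasureTheory in
lemma integral_passes_le (hxd : x ≤ d) (s : ℕ) :
    IntervalIntegrable (fun y => if Passes p y s then (1 : ℝ) else 0) volume x d ∧
    ∫ y in x..d, (if Passes p y s then (1 : ℝ) else 0) ≤
      |max (p (s + 1)) x - max (p s) x| := by
  have hset : (fun y => if Passes p y s then (1 : ℝ) else 0) =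
      Set.indicator (Set.Ico (min (p s) (p (s + 1))) (max (p s) (p (s + 1)))) 1 := by
    ext y
    rw [Set.indicator_apply]
    refine if_congr ?_ rfl rfl
    unfold Passes
    rw [Set.mem_Ico, min_le_iff, lt_max_iff]
    constructor
    · rintro (h | h)
      · exact ⟨Or.inl h.1, Or.inr h.2⟩
      · exact ⟨Or.inr h.1, Or.inl h.2⟩
    · rintro ⟨h1 | h1, h2 | h2⟩
      · exact absurd h2 (not_lt.2 h1)
      · exact Or.inl ⟨h1, h2⟩
      · exact Or.inr ⟨h1, h2⟩
      · exact absurd h2 (not_lt.2 h1)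
  rw [hset]
  constructor
  · rw [intervalIntegrable_iff]
    exact (integrableOn_const (by simp)).indicator measurableSet_Ico
  · rw [intervalIntegral.integral_of_le hxd, setIntegral_indicator measurableSet_Ico]
    simp only [Pi.one_apply, integral_const, smul_eq_mul, mul_one, measureReal_restrict_apply_univ]
    calc volume.real (Set.Ioc x d ∩ Set.Ico (min (p s) (p (s + 1))) (max (p s) (p (s + 1))))
        ≤ volume.real (Set.Icc (max (min (p s) (p (s + 1))) x)
            (max (max (p s) (p (s + 1))) x)) := by
          refine measureReal_mono ?_ (by simp)
          rintro y ⟨h1, h2⟩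
          exact ⟨max_le h2.1 h1.1.le, le_max_of_le_left h2.2.le⟩
      _ = |max (p (s + 1)) x - max (p s) x| := by
          rw [Real.volume_real_Icc]
          rcases le_total (p s) (p (s + 1)) with h | h
          · have h' := max_le_max h (le_refl x)
            rw [min_eq_left h, max_eq_right h, abs_of_nonneg (sub_nonneg.2 h'),
              max_eq_left (sub_nonneg.2 h')]
          · have h' := max_le_max h (le_refl x)
            rw [min_eq_right h, max_eq_left h, abs_sub_comm, abs_of_nonneg (sub_nonneg.2 h'),
              max_eq_left (sub_nonneg.2 h')]

open MeasureTheory in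
lemma integral_passCount_le (hxd : x ≤ d) :
    IntervalIntegrable (fun y => (passCount p x T i y : ℝ)) volume x d ∧
    ∫ y in x..d, (passCount p x T i y : ℝ) ≤ excursionLength p x T i := by
  have h1 : (fun y => (passCount p x T i y : ℝ)) =
      fun y => ∑ s ∈ excursion p x T i, if Passes p y s then (1 : ℝ) else 0 := by
    ext y
    rw [passCount, Finset.card_filter]
    push_cast
    rfl
  rw [h1]
  constructor
  · have h2 := IntervalIntegrable.sum (excursion p x T i)
      fun s _ => (integral_passes_le (p := p) hxd s).1
    simpa only [Finset.sum_fn] using h2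
  · rw [intervalIntegral.integral_finsetSum fun s _ => (integral_passes_le hxd s).1]
    exact Finset.sum_le_sum fun s _ => (integral_passes_le hxd s).2

end Path

lemma exists_top {α : Type*} [DecidableEq α] (E : Finset α) (f : α → ℝ) {m : ℕ}
    (hm : m ≤ E.card) :
    ∃ S ⊆ E, S.card = m ∧ ∀ a ∈ S, ∀ b ∈ E, b ∉ S → f b ≤ f a := by
  induction m with
  | zero => exact ⟨∅, by simp, rfl, by simp⟩
  | succ m ih =>
    obtain ⟨S, h1, h2, h3⟩ := ih (by omega)
    have hne : (E \ S).Nonempty := by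
      rw [← Finset.card_pos, Finset.card_sdiff_of_subset h1]; omega
    obtain ⟨c, hc, hmax⟩ := Finset.exists_max_image (E \ S) f hne
    rw [Finset.mem_sdiff] at hc
    refine ⟨insert c S, Finset.insert_subset hc.1 h1, by rw [Finset.card_insert_of_notMem hc.2, h2],
      fun a ha b hb hbS => ?_⟩
    rw [Finset.mem_insert, not_or] at hbS
    rcases Finset.mem_insert.1 ha with rfl | ha
    · exact hmax b (Finset.mem_sdiff.2 ⟨hb, hbS.2⟩)
    · exact h3 a ha b hb hbS.2

/-- The number of excursions beyond `x` of all jeeps. -/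
noncomputable def exitCount {N : ℕ} (P : Fin N → ℕ → ℝ) (T : ℕ) (x : ℝ) : ℕ :=
  ∑ j, exits (P j) x T

/-- The excursions beyond `x` of all jeeps. -/
noncomputable def excursions {N : ℕ} (P : Fin N → ℕ → ℝ) (T : ℕ) (x : ℝ) :
    Finset (Σ _ : Fin N, ℕ) :=
  Finset.univ.sigma fun j => Finset.range (exits (P j) x T)

lemma card_excursions {N : ℕ} (P : Fin N → ℕ → ℝ) (T : ℕ) (x : ℝ) :
    (excursions P T x).card = exitCount P T x := by
  simp [excursions, exitCount]

/-- Paths of jeeps that perform the task. -/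
structure Paths {N : ℕ} (d : ℝ) (n₁ n₂ m₁ T : ℕ) (P : Fin N → ℕ → ℝ) : Prop where
  zero : ∀ j, P j 0 = 0
  nonneg : ∀ j, ∀ t ≤ T, 0 ≤ P j t
  le : ∀ j, ∀ t ≤ T, P j t ≤ d
  outward : n₁ + n₂ ≤ ∑ j, crossings (P j) T 0 d
  back : n₂ ≤ ∑ j, crossings (P j) T d 0
  home : Set.ncard {j : Fin N | P j T ≠ 0} ≤ n₁ + m₁

section Paths

variable {N : ℕ} {d x y : ℝ} {n₁ n₂ m₁ m k T : ℕ} {P : Fin N → ℕ → ℝ}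

lemma Paths.le_exitCount (hP : Paths d n₁ n₂ m₁ T P) (hx : 0 ≤ x) (hxd : x < d) :
    n₁ + n₂ ≤ exitCount P T x :=
  hP.outward.trans (Finset.sum_le_sum fun _ _ => crossings_outward_le hx hxd)

lemma Paths.sum_away_le (hP : Paths d n₁ n₂ m₁ T P) (hx : 0 ≤ x) :
    ∑ j, (if x < P j T then 1 else 0) ≤ n₁ + m₁ := by
  refine le_trans ?_ hP.home
  rw [← Finset.card_filter, ← Set.ncard_coe_finset]
  refine Set.ncard_le_ncard ?_ (Set.toFinite _)
  intro j hj
  simp only [Finset.coe_filter, Finset.mem_univ, true_and, Set.mem_ofPred_eq] at hj ⊢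
  exact (hx.trans_lt hj).ne'

lemma Paths.le_sum_returns (hP : Paths d n₁ n₂ m₁ T P) (hx : 0 ≤ x) (hxd : x < d) :
    n₂ ≤ ∑ j, returns (P j) x T := by
  refine hP.back.trans (Finset.sum_le_sum fun j _ => (crossings_back_le hx hxd (hP.zero j)).trans ?_)
  refine le_trans (Finset.card_le_card fun i hi => ?_) (Finset.card_range (returns (P j) x T)).le
  simp only [Finset.mem_filter, Finset.mem_range] at hi ⊢
  exact hi.2.1

lemma Paths.exitCount_eq (hP : Paths d n₁ n₂ m₁ T P) (hx : 0 ≤ x) :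
    exitCount P T x = ∑ j, returns (P j) x T + ∑ j, if x < P j T then 1 else 0 := by
  rw [exitCount, ← Finset.sum_add_distrib]
  exact Finset.sum_congr rfl fun j _ => exits_eq (by rw [hP.zero j]; exact hx) T

lemma slope_le_of_le {k' z : ℕ} (hk : n₁ + n₂ ≤ k) (hkk : k ≤ k') (hz : z ≤ n₁ + m₁)
    (hz' : z + n₂ ≤ k') : slope n₁ n₂ m₁ m k + z ≤ 2 * k' := by
  unfold slope
  omega

/-- Some excursions beyond `x` need at least as much fuel as the oldest jeeps of the algorithm. -/
lemma Paths.exists_excursions (hP : Paths d n₁ n₂ m₁ T P) (hx : 0 ≤ x) (hxd : x < d) (m : ℕ) :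
    ∃ S ⊆ excursions P T x, S.card = min m (exitCount P T x) ∧
      ∀ y, x < y → y < d → ∀ k, n₁ + n₂ ≤ k → k ≤ exitCount P T x → k ≤ exitCount P T y →
        slope n₁ n₂ m₁ m k ≤ ∑ e ∈ S, passCount (P e.1) x T e.2 y := by
  classical
  have h0x : ∀ {z : ℝ}, 0 ≤ z → ∀ j, P j 0 ≤ z := fun hz j => by rw [hP.zero j]; exact hz
  let R : (Σ _ : Fin N, ℕ) → Prop := fun e =>
    e.2 < returns (P e.1) x T ∧ d ≤ depth (P e.1) x T e.2
  let D : (Σ _ : Fin N, ℕ) → ℝ := fun e => depth (P e.1) x T e.2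
  have hDd : ∀ e, D e ≤ d := fun e => depth_le hxd.le (hP.le e.1)
  obtain ⟨S, hS, hcard, htop⟩ := exists_top (excursions P T x) (fun e => D e + if R e then 1 else 0)
    (m := min m (exitCount P T x)) (by rw [card_excursions]; exact min_le_right _ _)
  have hlt : ∀ e ∈ excursions P T x, e.2 < exits (P e.1) x T := fun e he => by
    simpa [excursions] using he
  -- the round trips
  have hround : n₂ ≤ ((excursions P T x).filter R).card := by
    refine hP.back.trans ?_
    have : (excursions P T x).filter R = Finset.univ.sigma fun j =>
        (Finset.range (exits (P j) x T)).filter fun i =>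
          i < returns (P j) x T ∧ d ≤ depth (P j) x T i := by
      ext e
      simp [excursions, R]
    rw [this, Finset.card_sigma]
    exact Finset.sum_le_sum fun j _ => crossings_back_le hx hxd (hP.zero j)
  have hSround : min m n₂ ≤ (S.filter R).card := by
    by_cases h : (excursions P T x).filter R ⊆ S
    · have : (excursions P T x).filter R ⊆ S.filter R := fun e he =>
        Finset.mem_filter.2 ⟨h he, (Finset.mem_filter.1 he).2⟩
      exact (min_le_right _ _).trans (hround.trans (Finset.card_le_card this))
    · obtain ⟨b, hb, hbS⟩ := Finset.not_subset.1 h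
      rw [Finset.mem_filter] at hb
      have hall : S.filter R = S := by
        refine Finset.filter_true_of_mem fun a ha => ?_
        by_contra haR
        have h1 := htop a ha b hb.1 hbS
        rw [if_pos hb.2, if_neg haR] at h1
        have h2 := hDd a
        have h3 : d ≤ D b := hb.2.2
        linarith
      rw [hall, hcard]
      have := hP.le_exitCount hx hxd
      omega
  -- the excursions that do not end
  have hopen : (S.filter fun e => ¬ e.2 < returns (P e.1) x T).card ≤ n₁ + m₁ := by
    refine le_trans ?_ (hP.sum_away_le hx)
    have : S.filter (fun e => ¬ e.2 < returns (P e.1) x T) ⊆ Finset.univ.sigma fun j =>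
        (Finset.range (exits (P j) x T)).filter fun i => ¬ i < returns (P j) x T := by
      intro e he
      rw [Finset.mem_filter] at he
      simp only [Finset.mem_sigma, Finset.mem_univ, true_and, Finset.mem_filter, Finset.mem_range]
      exact ⟨hlt e (hS he.1), he.2⟩
    refine (Finset.card_le_card this).trans ?_
    rw [Finset.card_sigma]
    exact Finset.sum_le_sum fun j _ => (card_not_returns (h0x hx j)).le
  have hsplit : (S.filter fun e => ¬ e.2 < returns (P e.1) x T).card + (S.filter R).card ≤
      S.card := by
    rw [← Finset.card_union_of_disjoint]
    · exact Finset.card_le_card (Finset.union_subset (Finset.filter_subset _ _)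
        (Finset.filter_subset _ _))
    · rw [Finset.disjoint_filter]
      exact fun e _ h1 h2 => h1 h2.1
  refine ⟨S, hS, hcard, fun y hxy hyd k hk hkx hky => ?_⟩
  by_cases hdeep : ∀ e ∈ S, y < D e
  · have h1 : ∑ e ∈ S, (if e.2 < returns (P e.1) x T then 2 else 1) ≤
        ∑ e ∈ S, passCount (P e.1) x T e.2 y := Finset.sum_le_sum fun e he =>
      le_passCount (h0x hx e.1) hxy.le (hlt e (hS he)) (hdeep e he)
    have h2 : ∑ e ∈ S, (if e.2 < returns (P e.1) x T then 2 else 1) +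
        (S.filter fun e => ¬ e.2 < returns (P e.1) x T).card = 2 * S.card := by
      rw [Finset.card_filter, ← Finset.sum_add_distrib, mul_comm, ← smul_eq_mul,
        ← Finset.sum_const]
      refine Finset.sum_congr rfl fun e _ => ?_
      split_ifs <;> rfl
    have h3 := slope_le (m₁ := m₁) (m := m) hk hkx hopen (by omega) (fun _ => by omega)
    omega
  · push Not at hdeep
    obtain ⟨a, ha, hay⟩ := hdeep
    have h1 : ∑ e ∈ S, passCount (P e.1) x T e.2 y =
        ∑ e ∈ excursions P T x, passCount (P e.1) x T e.2 y := by
      refine Finset.sum_subset hS fun b hb hbS => passCount_eq_zero hxy.le ?_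
      have h2 := htop a ha b hb hbS
      have haR : ¬ R a := fun h => by
        have : d ≤ D a := h.2
        linarith
      rw [if_neg haR] at h2
      have h3 : (0 : ℝ) ≤ if R b then 1 else 0 := by split_ifs <;> norm_num
      have : D b ≤ y := by linarith
      exact this
    have h2 : ∑ e ∈ excursions P T x, passCount (P e.1) x T e.2 y =
        exitCount P T y + ∑ j, returns (P j) y T := by
      rw [excursions, Finset.sum_sigma, exitCount, ← Finset.sum_add_distrib]
      exact Finset.sum_congr rfl fun j _ => sum_passCount (h0x hx j) hxy.le
    have hy : 0 ≤ y := hx.trans hxy.le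
    have h3 := hP.exitCount_eq hy
    have h4 := hP.le_sum_returns hy hyd
    have h5 := slope_le_of_le (m := m) hk hky (hP.sum_away_le hy) (by omega)
    omega

/-- The number of jeeps in the convoy of the algorithm at `y`. -/
noncomputable def convoySize (n : ℕ) : List ℝ → ℝ → ℕ
  | [], _ => n
  | a :: L, y => if y < a then n + L.length + 1 else convoySize n L y

lemma le_convoySize (n : ℕ) (L : List ℝ) (y : ℝ) : n ≤ convoySize n L y := by
  induction L with
  | nil => exact le_rfl
  | cons a L ih => unfold convoySize; split_ifs <;> omega

lemma convoySize_le (n : ℕ) (L : List ℝ) (y : ℝ) : convoySize n L y ≤ n + L.length := by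
  induction L with
  | nil => exact le_rfl
  | cons a L ih => unfold convoySize; rw [List.length_cons]; split_ifs <;> omega

lemma convoySize_anti (n : ℕ) (L : List ℝ) (hxy : x ≤ y) : convoySize n L y ≤ convoySize n L x := by
  induction L with
  | nil => exact le_rfl
  | cons a L ih =>
    have := convoySize_le n L y
    unfold convoySize
    split_ifs with h1 h2
    · exact le_rfl
    · exact absurd (hxy.trans_lt h1) h2
    · omega
    · exact ih

open MeasureTheory in
lemma demand_le_integral {n : ℕ} {f : ℕ → ℝ} {F : ℝ → ℝ} {L : List ℝ} (hL : ∀ a ∈ L, a ≤ d)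
    (hxd : x ≤ d) (hF : IntervalIntegrable F volume x d)
    (h : ∀ y, x < y → y < d → f (convoySize n L y) ≤ F y) :
    demand d n f L x ≤ ∫ y in x..d, F y := by
  induction L generalizing x with
  | nil =>
    have := intervalIntegral.integral_mono_on_of_le_Ioo hxd (f := fun _ => f n) (by simp) hF
      (fun y hy => h y hy.1 hy.2)
    simpa [demand] using this
  | cons a L ih =>
    have hL' : ∀ b ∈ L, b ≤ d := fun b hb => hL b (by simp [hb])
    rcases le_or_gt a x with hax | hxa
    · have h1 := ih hL' hxd hF fun y h1 h2 => by
        have := h y h1 h2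
        rwa [convoySize, if_neg (by linarith)] at this
      simpa [demand, hax] using h1
    · have had : a ≤ d := hL a (by simp)
      have hF1 : IntervalIntegrable F volume x a := hF.mono_set (by
        rw [Set.uIcc_of_le hxd, Set.uIcc_of_le hxa.le]
        exact Set.Icc_subset_Icc le_rfl had)
      have hF2 : IntervalIntegrable F volume a d := hF.mono_set (by
        rw [Set.uIcc_of_le hxd, Set.uIcc_of_le had]
        exact Set.Icc_subset_Icc hxa.le le_rfl)
      have h1 := ih hL' had hF2 fun y h1 h2 => by
        have := h y (hxa.trans h1) h2
        rwa [convoySize, if_neg h1.not_gt] at this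
      have h2 := intervalIntegral.integral_mono_on_of_le_Ioo hxa.le
        (f := fun _ => f (n + L.length + 1)) (by simp) hF1 (fun y hy => by
          have := h y hy.1 (hy.2.trans_le had)
          rwa [convoySize, if_pos hy.2] at this)
      rw [← intervalIntegral.integral_add_adjacent_intervals hF1 hF2]
      simp only [intervalIntegral.integral_const, smul_eq_mul] at h2
      simp only [demand, max_eq_left hxa.le, max_eq_left (sub_nonneg.2 hxa.le)]
      linarith

lemma Certified.le {B : ℕ} {C : ℝ} {w : ℝ →₀ ℝ} {L : List ℝ}
    (hL : Certified B C d n₁ n₂ m₁ w L) : ∀ a ∈ L, a ≤ d := by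
  induction L with
  | nil => simp
  | cons a L ih =>
    intro b hb
    rcases List.mem_cons.1 hb with rfl | hb
    · exact hL.2.1
    · exact ih hL.1 b hb

lemma Paths.exists_demand_le (hP : Paths d n₁ n₂ m₁ T P) (hx : 0 ≤ x) (hxd : x < d) {L : List ℝ}
    (hL : ∀ a ∈ L, a ≤ d)
    (hsize : ∀ y, x ≤ y → y < d → convoySize (n₁ + n₂) L y ≤ exitCount P T y) (m : ℕ) :
    ∃ S ⊆ excursions P T x, S.card = min m (exitCount P T x) ∧
      demand d (n₁ + n₂) (fun k => slope n₁ n₂ m₁ m k) L x ≤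
        ∑ e ∈ S, excursionLength (P e.1) x T e.2 := by
  obtain ⟨S, h1, h2, h3⟩ := hP.exists_excursions hx hxd m
  refine ⟨S, h1, h2, ?_⟩
  have hint : IntervalIntegrable (fun y => ∑ e ∈ S, (passCount (P e.1) x T e.2 y : ℝ))
      MeasureTheory.volume x d := by
    have := IntervalIntegrable.sum S fun e _ =>
      (integral_passCount_le (p := P e.1) (T := T) (i := e.2) hxd.le).1
    simpa only [Finset.sum_fn] using this
  refine (demand_le_integral hL hxd.le hint fun y hxy hyd => ?_).trans ?_
  · exact_mod_cast h3 y hxy hyd _ (le_convoySize _ _ _)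
      ((convoySize_anti _ _ hxy.le).trans (hsize x le_rfl hxd)) (hsize y hxy.le hyd)
  · rw [intervalIntegral.integral_finsetSum fun e _ => (integral_passCount_le hxd.le).1]
    exact Finset.sum_le_sum fun e _ => (integral_passCount_le hxd.le).2

end Paths

/-! ### Normal algorithms -/

section Normal

variable {B N M : ℕ} {C d x : ℝ} {σ τ : Field N M}

/-- All amounts of fuel are within the capacities, and all jeeps are in the desert. -/
structure Field.Proper (C d : ℝ) (σ : Field N M) : Prop where
  pos_mem : ∀ j, σ.jeepPos j ∈ Set.Icc 0 d
  tank_mem : ∀ j, σ.tank j ∈ Set.Icc (0 : ℝ) 1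
  can_mem : ∀ k, σ.canFuel k ∈ Set.Icc 0 C

lemma Field.proper_initial (hC : 0 < C) (hd : 0 < d) : (Field.initial N M).Proper C d where
  pos_mem _ := ⟨le_rfl, hd.le⟩
  tank_mem _ := ⟨le_rfl, zero_le_one⟩
  can_mem _ := ⟨le_rfl, hC.le⟩

lemma forall_update {α : Type*} [DecidableEq α] {f : α → ℝ} {a : α} {v : ℝ} {s : Set ℝ}
    (hf : ∀ b, f b ∈ s) (hv : v ∈ s) (b : α) : Function.update f a v b ∈ s := by
  rw [Function.update_apply]
  split_ifs
  · exact hv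
  · exact hf b

lemma NormalStep.proper (h : NormalStep B C d σ τ) (hσ : σ.Proper C d) : τ.Proper C d := by
  obtain ⟨h1, h2, h3⟩ := hσ
  cases h with
  | drive j y S hy hS hpos hfuel =>
    have := abs_nonneg (y - σ.jeepPos j)
    have := (h2 j).2
    exact ⟨forall_update h1 hy, forall_update h2 ⟨by linarith, by linarith⟩, h3⟩
  | refuel j k q hpos hq hk hj =>
    have := (h2 j).1
    have := (h3 k).2
    exact ⟨h1, forall_update h2 ⟨by linarith, hj⟩, forall_update h3 ⟨by linarith, by linarith⟩⟩
  | pour k l q hkl hpos hq hk hl =>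
    have := (h3 l).1
    have := (h3 k).2
    exact ⟨h1, h2, forall_update (forall_update h3 ⟨by linarith, by linarith⟩) ⟨by linarith, hl⟩⟩
  | tankAtBorder j t hpos ht => exact ⟨h1, forall_update h2 ht, h3⟩
  | canAtBorder k t hpos ht => exact ⟨h1, h2, forall_update h3 ht⟩

lemma sum_update_sub {α : Type*} [Fintype α] [DecidableEq α] (f : α → ℝ) (a : α) (v : ℝ) :
    ∑ b, (Function.update f a v b - f b) = v - f a := by
  rw [Finset.sum_eq_single a]
  · simp
  · intro b _ hb
    rw [Function.update_of_ne hb, sub_self]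
  · simp

/-- The fuel taken from the supply is burnt or in tanks and cans. -/
lemma NormalStep.drawn_eq (h : NormalStep B C d σ τ) :
    τ.drawn - σ.drawn = ∑ j, (τ.tank j - σ.tank j) + ∑ j, |τ.jeepPos j - σ.jeepPos j| +
      ∑ k, (τ.canFuel k - σ.canFuel k) := by
  cases h with
  | drive j y S hy hS hpos hfuel =>
    have : ∑ i, |Function.update σ.jeepPos j y i - σ.jeepPos i| = |y - σ.jeepPos j| := by
      rw [Finset.sum_eq_single j]
      · simp
      · intro b _ hb
        rw [Function.update_of_ne hb, sub_self, abs_zero]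
      · simp
    simp only [sum_update_sub, this]
    simp
  | refuel j k q hpos hq hk hj =>
    simp only [sum_update_sub]
    simp
  | pour k l q hkl hpos hq hk hl =>
    have : ∑ i, (Function.update (Function.update σ.canFuel k (σ.canFuel k - q)) l
        (σ.canFuel l + q) i - σ.canFuel i) = 0 := by
      have h1 := sum_update_sub (Function.update σ.canFuel k (σ.canFuel k - q)) l (σ.canFuel l + q)
      have h2 := sum_update_sub σ.canFuel k (σ.canFuel k - q)
      rw [Function.update_of_ne hkl.symm] at h1
      rw [Finset.sum_sub_distrib] at *
      linarith
    simp [this]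
  | tankAtBorder j t hpos ht =>
    simp only [sum_update_sub]
    simp
  | canAtBorder k t hpos ht =>
    simp only [sum_update_sub]
    simp

/-- A ride makes no fuel beyond `x` available other than one tank per exit. -/
lemma ride_balance_le {a b t u v : ℝ} (hv : 0 ≤ v) (ht : t ≤ 1) (hab : |b - a| ≤ t)
    (huv : ¬ (a ≤ x ∧ x < b) → v = u) :
    v * |max b x - max a x| - (if a ≤ x ∧ x < b then v else 0) +
      (if x < b then v * (t - |b - a|) else 0) - (if x < a then u * t else 0) ≤ 0 := by
  rcases lt_or_ge x a with ha | ha <;> rcases lt_or_ge x b with hb | hb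
  · rw [max_eq_left ha.le, max_eq_left hb.le, if_neg (fun h => absurd ha (not_lt.2 h.1)), if_pos hb,
      if_pos ha, huv (fun h => absurd ha (not_lt.2 h.1))]
    linarith
  · rw [max_eq_left ha.le, max_eq_right hb, if_neg (fun h => absurd ha (not_lt.2 h.1)),
      if_neg hb.not_gt, if_pos ha, ← huv (fun h => absurd ha (not_lt.2 h.1)),
      abs_of_nonpos (by linarith)]
    rw [abs_of_nonpos (by linarith)] at hab
    nlinarith
  · rw [max_eq_right ha, max_eq_left hb.le, if_pos ⟨ha, hb⟩, if_pos hb, if_neg ha.not_gt,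
      abs_of_nonneg (by linarith), abs_of_nonneg (by linarith)]
    nlinarith
  · rw [max_eq_right ha, max_eq_right hb, if_neg (fun h => absurd h.2 (not_lt.2 hb)),
      if_neg hb.not_gt, if_neg ha.not_gt]
    simp

/-- The change of the balance of jeep `j` beyond `x`, if its excursions have weight `u` before and
`v` after an action. -/
noncomputable def jeepChange (x : ℝ) (σ τ : Field N M) (u v : Fin N → ℝ) (j : Fin N) : ℝ :=
  v j * |max (τ.jeepPos j) x - max (σ.jeepPos j) x| -
    (if σ.jeepPos j ≤ x ∧ x < τ.jeepPos j then v j else 0) +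
    (if x < τ.jeepPos j then v j * τ.tank j else 0) -
    (if x < σ.jeepPos j then u j * σ.tank j else 0)

/-- The can fuel beyond `x`. -/
noncomputable def canBeyond (x : ℝ) (σ : Field N M) (k : Fin M) : ℝ :=
  if x < σ.canPos k then σ.canFuel k else 0

lemma jeepChange_of_eq {u v : Fin N → ℝ} {j : Fin N} (hpos : τ.jeepPos j = σ.jeepPos j)
    (huv : ¬ (σ.jeepPos j ≤ x ∧ x < τ.jeepPos j) → v j = u j) :
    jeepChange x σ τ u v j = if x < σ.jeepPos j then v j * (τ.tank j - σ.tank j) else 0 := by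
  have hn : ¬ (σ.jeepPos j ≤ x ∧ x < τ.jeepPos j) := by rw [hpos]; exact fun h => by linarith [h.1, h.2]
  have := huv hn
  unfold jeepChange
  rw [if_neg hn, hpos, this]
  split_ifs
  · simp; ring
  · simp

lemma NormalStep.balance_le (h : NormalStep B C d σ τ) (hσ : σ.Proper C d) (hC : 0 < C) (hx : 0 ≤ x)
    {u v : Fin N → ℝ} (hv0 : ∀ j, 0 ≤ v j) (hv1 : ∀ j, v j ≤ 1)
    (huv : ∀ j, ¬ (σ.jeepPos j ≤ x ∧ x < τ.jeepPos j) → v j = u j) :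
    ∑ j, jeepChange x σ τ u v j + ∑ k, (canBeyond x τ k - canBeyond x σ k) ≤
      (∑ j, if σ.jeepPos j ≤ x ∧ x < τ.jeepPos j then 1 else 0) * (B * C) := by
  have hstay : ∀ j, τ.jeepPos j = σ.jeepPos j → jeepChange x σ τ u v j =
      if x < σ.jeepPos j then v j * (τ.tank j - σ.tank j) else 0 := fun j h =>
    jeepChange_of_eq h (huv j)
  have hrest : ∀ j, τ.jeepPos j = σ.jeepPos j → τ.tank j = σ.tank j → jeepChange x σ τ u v j = 0 := by
    intro j h1 h2
    rw [hstay j h1, h2]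
    simp
  have hRHS : 0 ≤ (∑ j, if σ.jeepPos j ≤ x ∧ x < τ.jeepPos j then (1 : ℝ) else 0) * (B * C) :=
    mul_nonneg (Finset.sum_nonneg fun j _ => by split_ifs <;> norm_num) (by positivity)
  cases h with
  | drive j y S hy hS hpos hfuel =>
    have hj : ∀ i, jeepChange x σ { σ with
          jeepPos := Function.update σ.jeepPos j y
          tank := Function.update σ.tank j (σ.tank j - |y - σ.jeepPos j|)
          canPos := fun k => if k ∈ S then y else σ.canPos k } u v i ≤ 0 := by
      intro i
      by_cases hi : i = j
      · subst hi
        have h1 := huv i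
        unfold jeepChange
        simp only [Function.update_self] at h1 ⊢
        exact ride_balance_le (hv0 i) (hσ.tank_mem i).2 hfuel h1
      · refine (hrest i ?_ ?_).le <;> simp [Function.update_of_ne hi]
    refine le_trans (add_le_add_left (Finset.sum_nonpos fun i _ => hj i) _) ?_
    rw [zero_add]
    by_cases hout : σ.jeepPos j ≤ x ∧ x < y
    · have h1 : (1 : ℝ) ≤ ∑ i, if σ.jeepPos i ≤ x ∧ x < Function.update σ.jeepPos j y i
          then 1 else 0 := by
        refine le_trans (by simp [hout]) (Finset.single_le_sum (f := fun i =>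
          if σ.jeepPos i ≤ x ∧ x < Function.update σ.jeepPos j y i then (1 : ℝ) else 0)
          (fun i _ => by split_ifs <;> norm_num) (Finset.mem_univ j))
      have h2 : ∑ k, (canBeyond x { σ with
          jeepPos := Function.update σ.jeepPos j y
          tank := Function.update σ.tank j (σ.tank j - |y - σ.jeepPos j|)
          canPos := fun k => if k ∈ S then y else σ.canPos k } k - canBeyond x σ k) ≤
          ∑ k, if k ∈ S then C else 0 := by
        refine Finset.sum_le_sum fun k _ => ?_
        have h3 := hσ.can_mem k
        simp only [canBeyond]
        by_cases hk : k ∈ S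
        · simp only [hk, if_true, if_pos hout.2]
          split_ifs <;> linarith [h3.1, h3.2]
        · simp [hk]
      refine h2.trans ?_
      rw [Finset.sum_ite_mem, Finset.univ_inter, Finset.sum_const, nsmul_eq_mul]
      have h4 : (S.card : ℝ) * C ≤ B * C := mul_le_mul_of_nonneg_right (Nat.cast_le.2 hS) hC.le
      have h5 : (0 : ℝ) ≤ B * C := by positivity
      refine h4.trans ?_
      nlinarith
    · refine le_trans (Finset.sum_nonpos fun k _ => ?_) hRHS
      have h3 := hσ.can_mem k
      simp only [canBeyond]
      by_cases hk : k ∈ S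
      · simp only [hk, if_true, hpos k hk]
        split_ifs with h1 h2
        · simp
        · exact absurd ⟨not_lt.1 h2, h1⟩ hout
        · linarith [h3.1]
        · simp
      · simp [hk]
  | refuel j k q hpos hq hk hj =>
    refine le_trans ?_ hRHS
    have h1 : ∑ i, jeepChange x σ { σ with
          tank := Function.update σ.tank j (σ.tank j + q)
          canFuel := Function.update σ.canFuel k (σ.canFuel k - q) } u v i ≤
        if x < σ.jeepPos j then q else 0 := by
      rw [Finset.sum_eq_single j]
      · rw [hstay j rfl]
        simp only [Function.update_self, add_sub_cancel_left]
        split_ifs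
        · exact mul_le_of_le_one_left hq (hv1 j)
        · exact le_rfl
      · intro i _ hi
        exact hrest i rfl (Function.update_of_ne hi _ _)
      · simp
    have h2 : ∑ i, (canBeyond x { σ with
          tank := Function.update σ.tank j (σ.tank j + q)
          canFuel := Function.update σ.canFuel k (σ.canFuel k - q) } i - canBeyond x σ i) =
        if x < σ.jeepPos j then -q else 0 := by
      rw [Finset.sum_eq_single k]
      · simp only [canBeyond, Function.update_self, hpos]
        split_ifs <;> simp
      · intro i _ hi
        simp only [canBeyond, Function.update_of_ne hi, sub_self]
      · simp
    rw [h2]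
    split_ifs at h1 ⊢ <;> linarith
  | pour k l q hkl hpos hq hk hl =>
    refine le_trans ?_ hRHS
    rw [Finset.sum_eq_zero fun j _ => hrest j rfl rfl, zero_add]
    have h1 : ∀ i, canBeyond x { σ with
          canFuel := Function.update (Function.update σ.canFuel k (σ.canFuel k - q)) l
            (σ.canFuel l + q) } i - canBeyond x σ i =
        (if i = l then (if x < σ.canPos l then q else 0) else 0) -
          (if i = k then (if x < σ.canPos l then q else 0) else 0) := by
      intro i
      simp only [canBeyond]
      by_cases hil : i = l
      · subst hil
        rw [if_neg hkl.symm, if_pos rfl, Function.update_self]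
        split_ifs <;> simp
      · rw [if_neg hil, Function.update_of_ne hil]
        by_cases hik : i = k
        · subst hik
          rw [if_pos rfl, Function.update_self, hpos]
          split_ifs <;> simp
        · rw [if_neg hik, Function.update_of_ne hik]; simp
    rw [Finset.sum_congr rfl fun i _ => h1 i, Finset.sum_sub_distrib]
    simp
  | tankAtBorder j t hpos ht =>
    refine le_trans ?_ hRHS
    have h1 : ∀ i, jeepChange x σ { σ with
          tank := Function.update σ.tank j t
          drawn := σ.drawn + (t - σ.tank j) } u v i = 0 := by
      intro i
      by_cases hi : i = j
      · subst hi
        rw [hstay i rfl, if_neg (by rw [hpos]; exact hx.not_gt)]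
      · exact hrest i rfl (Function.update_of_ne hi _ _)
    rw [Finset.sum_eq_zero fun i _ => h1 i, zero_add]
    simp [canBeyond]
  | canAtBorder k t hpos ht =>
    refine le_trans ?_ hRHS
    rw [Finset.sum_eq_zero fun j _ => hrest j rfl rfl, zero_add]
    refine (Finset.sum_eq_zero fun i _ => ?_).le
    simp only [canBeyond]
    by_cases hi : i = k
    · subst hi
      rw [if_neg (by rw [hpos]; exact hx.not_gt), if_neg (by rw [hpos]; exact hx.not_gt), sub_self]
    · rw [Function.update_of_ne hi, sub_self]

end Normal

/-- The indicator of the times at which the excursion beyond `x` belongs to `I`. -/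
noncomputable def excursionWeight (p : ℕ → ℝ) (x : ℝ) (I : Finset ℕ) (t : ℕ) : ℝ :=
  if exits p x t - 1 ∈ I then 1 else 0

section Path

variable {p : ℕ → ℝ} {x : ℝ} {T : ℕ}

lemma excursionWeight_nonneg (I : Finset ℕ) (t : ℕ) : 0 ≤ excursionWeight p x I t := by
  unfold excursionWeight; split_ifs <;> norm_num

lemma excursionWeight_le_one (I : Finset ℕ) (t : ℕ) : excursionWeight p x I t ≤ 1 := by
  unfold excursionWeight; split_ifs <;> norm_num

lemma sum_excursionLength_le (I : Finset ℕ) :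
    ∑ i ∈ I, excursionLength p x T i ≤ ∑ s ∈ Finset.range T,
      excursionWeight p x I (s + 1) * |max (p (s + 1)) x - max (p s) x| := by
  unfold excursionLength excursion
  simp only [Finset.sum_filter]
  rw [Finset.sum_comm]
  refine Finset.sum_le_sum fun s _ => ?_
  rcases Nat.eq_zero_or_pos (exits p x (s + 1)) with h | h
  · rw [Finset.sum_eq_zero fun i _ => by rw [if_neg (by omega)]]
    exact mul_nonneg (excursionWeight_nonneg _ _) (abs_nonneg _)
  · have h1 : ∀ i, (exits p x (s + 1) = i + 1) ↔ exits p x (s + 1) - 1 = i := by omega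
    simp only [h1, Finset.sum_ite_eq]
    unfold excursionWeight
    split_ifs <;> simp

lemma excursionLength_nonneg {i : ℕ} : 0 ≤ excursionLength p x T i :=
  Finset.sum_nonneg fun _ _ => abs_nonneg _

lemma sum_excursionLength_le_length (I : Finset ℕ) :
    ∑ i ∈ I, excursionLength p x T i ≤ ∑ s ∈ Finset.range T, |p (s + 1) - p s| := by
  refine (sum_excursionLength_le I).trans (Finset.sum_le_sum fun s _ => ?_)
  have h1 := mul_le_of_le_one_left (abs_nonneg (max (p (s + 1)) x - max (p s) x))
    (excursionWeight_le_one (p := p) (x := x) I (s + 1))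
  exact h1.trans (abs_max_sub_max_le_abs _ _ _)

lemma sum_excursionWeight_le (I : Finset ℕ) :
    ∑ s ∈ Finset.range T, (if p s ≤ x ∧ x < p (s + 1) then excursionWeight p x I (s + 1) else 0) ≤
      I.card := by
  unfold excursionWeight
  have h1 : ∀ s, (if p s ≤ x ∧ x < p (s + 1) then
      (if exits p x (s + 1) - 1 ∈ I then (1 : ℝ) else 0) else 0) =
      if (p s ≤ x ∧ x < p (s + 1)) ∧ exits p x (s + 1) - 1 ∈ I then 1 else 0 := by
    intro s
    simp only [ite_and]
  simp only [h1]
  rw [Finset.sum_boole, Nat.cast_le]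
  refine Finset.card_le_card_of_injOn (fun s => exits p x (s + 1) - 1)
    (fun s hs => (Finset.mem_filter.1 hs).2.2) ?_
  have key : ∀ s s', s < s' → (p s ≤ x ∧ x < p (s + 1)) → (p s' ≤ x ∧ x < p (s' + 1)) →
      exits p x (s + 1) - 1 ≠ exits p x (s' + 1) - 1 := by
    intro s s' h h2 h3
    have h4 := exits_mono (p := p) (x := x) (show s + 1 ≤ s' by omega)
    have h5 := exits_succ (p := p) (x := x) (t := s)
    have h6 := exits_succ (p := p) (x := x) (t := s')
    rw [if_pos h2] at h5
    rw [if_pos h3] at h6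
    omega
  intro s hs s' hs' h
  have h2 := (Finset.mem_filter.1 hs).2.1
  have h3 := (Finset.mem_filter.1 hs').2.1
  rcases lt_trichotomy s s' with h4 | h4 | h4
  · exact absurd h (key s s' h4 h2 h3)
  · exact h4
  · exact absurd h.symm (key s' s h4 h3 h2)

end Path

namespace NormalAlgorithm

variable {B N : ℕ} {C d x : ℝ} {n₁ n₂ m₁ : ℕ} {w : ℝ →₀ ℝ}
  (A : NormalAlgorithm B C d n₁ n₂ m₁ w N)

/-- The path of a jeep. -/
def path (j : Fin N) (t : ℕ) : ℝ := (A.state t).jeepPos j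

lemma proper (hC : 0 < C) (hd : 0 < d) {t : ℕ} (ht : t ≤ A.T) : (A.state t).Proper C d := by
  induction t with
  | zero => rw [A.start]; exact Field.proper_initial hC hd
  | succ t ih => exact (A.step t (by omega)).proper (ih (by omega))

lemma paths (hC : 0 < C) (hd : 0 < d) : Paths d n₁ n₂ m₁ A.T A.path where
  zero j := by simp [path, A.start, Field.initial]
  nonneg j t ht := ((A.proper hC hd ht).pos_mem j).1
  le j t ht := ((A.proper hC hd ht).pos_mem j).2
  outward := A.outward
  back := A.back
  home := A.home

lemma drawn_eq {t : ℕ} (ht : t ≤ A.T) : (A.state t).drawn = ∑ j, (A.state t).tank j +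
    ∑ j, ∑ s ∈ Finset.range t, |A.path j (s + 1) - A.path j s| +
    ∑ k, (A.state t).canFuel k := by
  induction t with
  | zero => rw [A.start]; simp [Field.initial]
  | succ t ih =>
    have h1 := (A.step t (by omega)).drawn_eq
    have h2 := ih (by omega)
    simp only [Finset.sum_range_succ, Finset.sum_add_distrib]
    simp only [Finset.sum_sub_distrib, path] at *
    linarith

lemma balance_le (hC : 0 < C) (hd : 0 < d) (hx : 0 ≤ x) (I : Fin N → Finset ℕ) {t : ℕ}
    (ht : t ≤ A.T) :
    ∑ j, (∑ s ∈ Finset.range t, excursionWeight (A.path j) x (I j) (s + 1) *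
          |max (A.path j (s + 1)) x - max (A.path j s) x| -
        ∑ s ∈ Finset.range t, (if A.path j s ≤ x ∧ x < A.path j (s + 1) then
          excursionWeight (A.path j) x (I j) (s + 1) else 0) +
        if x < A.path j t then excursionWeight (A.path j) x (I j) t * (A.state t).tank j else 0) +
      ∑ k, canBeyond x (A.state t) k ≤ exitCount A.path t x * (B * C) := by
  induction t with
  | zero =>
    simp [exitCount, exits_zero, canBeyond, path, A.start, Field.initial]
  | succ t ih =>
    have h1 := (A.step t (by omega)).balance_le (x := x) (A.proper hC hd (by omega)) hC hx
      (u := fun j => excursionWeight (A.path j) x (I j) t)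
      (v := fun j => excursionWeight (A.path j) x (I j) (t + 1))
      (fun j => excursionWeight_nonneg _ _) (fun j => excursionWeight_le_one _ _)
      (fun j hj => by
        simp only [excursionWeight]
        rw [exits_succ, if_neg (show ¬ (A.path j t ≤ x ∧ x < A.path j (t + 1)) from hj), add_zero])
    have h2 := ih (by omega)
    have h3 : (exitCount A.path (t + 1) x : ℝ) = exitCount A.path t x +
        ∑ j, if (A.state t).jeepPos j ≤ x ∧ x < (A.state (t + 1)).jeepPos j then 1 else 0 := by
      simp only [exitCount, exits_succ, Finset.sum_add_distrib]
      push_cast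
      rfl
    rw [h3, add_mul]
    refine le_trans (le_of_eq ?_) (add_le_add h2 h1)
    rw [Finset.sum_sub_distrib, add_add_add_comm, ← Finset.sum_add_distrib]
    congr 1
    · refine Finset.sum_congr rfl fun j _ => ?_
      have h4 : jeepChange x (A.state t) (A.state (t + 1))
          (fun j => excursionWeight (A.path j) x (I j) t)
          (fun j => excursionWeight (A.path j) x (I j) (t + 1)) j =
          excursionWeight (A.path j) x (I j) (t + 1) *
            |max (A.path j (t + 1)) x - max (A.path j t) x| -
          (if A.path j t ≤ x ∧ x < A.path j (t + 1) then
            excursionWeight (A.path j) x (I j) (t + 1) else 0) +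
          (if x < A.path j (t + 1) then
            excursionWeight (A.path j) x (I j) (t + 1) * (A.state (t + 1)).tank j else 0) -
          (if x < A.path j t then
            excursionWeight (A.path j) x (I j) t * (A.state t).tank j else 0) := rfl
      rw [h4, Finset.sum_range_succ, Finset.sum_range_succ]
      ring
    · ring

lemma weightBeyond_le (hC : 0 < C) (hd : 0 < d) :
    weightBeyond w x ≤ ∑ k, canBeyond x (A.state A.T) k := by
  have hcan := fun k => ((A.proper hC hd le_rfl).can_mem k).1
  unfold weightBeyond canBeyond
  rw [← Finset.sum_filter]
  calc ∑ p ∈ w.support with x < p, w p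
      ≤ ∑ p ∈ w.support with x < p, ∑ k with (A.state A.T).canPos k = p,
          (A.state A.T).canFuel k := Finset.sum_le_sum fun p hp =>
        A.depots p (Finsupp.mem_support_iff.1 (Finset.mem_filter.1 hp).1)
    _ = ∑ p ∈ w.support with x < p, ∑ k ∈ Finset.univ.filter (fun k => x < (A.state A.T).canPos k)
          with (A.state A.T).canPos k = p, (A.state A.T).canFuel k := by
        refine Finset.sum_congr rfl fun p hp => Finset.sum_congr ?_ fun _ _ => rfl
        ext k
        simp only [Finset.mem_filter, Finset.mem_univ, true_and]
        refine ⟨fun h => ⟨?_, h⟩, fun h => h.2⟩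
        rw [h]
        exact (Finset.mem_filter.1 hp).2
    _ ≤ _ := Finset.sum_fiberwise_le_sum_of_sum_fiber_nonneg
        fun _ _ => Finset.sum_nonneg fun k _ => hcan k

/-- The fuel beyond `x` is brought there in tanks and cans. -/
lemma budget (hC : 0 < C) (hd : 0 < d) (hx : 0 ≤ x) {S : Finset (Σ _ : Fin N, ℕ)}
    (hS : S ⊆ excursions A.path A.T x) :
    ∑ e ∈ S, excursionLength (A.path e.1) x A.T e.2 + weightBeyond w x ≤
      S.card + exitCount A.path A.T x * (B * C) := by
  classical
  let I : Fin N → Finset ℕ := fun j =>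
    (Finset.range (exits (A.path j) x A.T)).filter fun i => (⟨j, i⟩ : Σ _ : Fin N, ℕ) ∈ S
  have hSI : S = Finset.univ.sigma I := by
    ext ⟨j, i⟩
    simp only [Finset.mem_sigma, Finset.mem_univ, true_and, I, Finset.mem_filter, Finset.mem_range]
    refine ⟨fun h => ⟨?_, h⟩, fun h => h.2⟩
    simpa [excursions] using hS h
  have h1 := A.balance_le hC hd hx I le_rfl
  have h2 := A.weightBeyond_le (x := x) hC hd
  have h3 : ∑ j, (∑ i ∈ I j, excursionLength (A.path j) x A.T i - (I j).card) ≤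
      ∑ j, (∑ s ∈ Finset.range A.T, excursionWeight (A.path j) x (I j) (s + 1) *
          |max (A.path j (s + 1)) x - max (A.path j s) x| -
        ∑ s ∈ Finset.range A.T, (if A.path j s ≤ x ∧ x < A.path j (s + 1) then
          excursionWeight (A.path j) x (I j) (s + 1) else 0) +
        if x < A.path j A.T then
          excursionWeight (A.path j) x (I j) A.T * (A.state A.T).tank j else 0) := by
    refine Finset.sum_le_sum fun j _ => ?_
    have h4 := sum_excursionLength_le (p := A.path j) (x := x) (T := A.T) (I j)
    have h5 := sum_excursionWeight_le (p := A.path j) (x := x) (T := A.T) (I j)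
    have h6 : 0 ≤ if x < A.path j A.T then
        excursionWeight (A.path j) x (I j) A.T * (A.state A.T).tank j else 0 := by
      split_ifs
      · exact mul_nonneg (excursionWeight_nonneg _ _) ((A.proper hC hd le_rfl).tank_mem j).1
      · exact le_rfl
    linarith
  rw [Finset.sum_sub_distrib] at h3
  rw [hSI, Finset.sum_sigma, Finset.card_sigma]
  push_cast
  linarith

lemma convoySize_le_exitCount (hB : 0 < B) (hC : 0 < C) (hd : 0 < d) {L : List ℝ}
    (hL : Certified B C d n₁ n₂ m₁ w L) (hx : 0 ≤ x) (hxd : x < d) :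
    convoySize (n₁ + n₂) L x ≤ exitCount A.path A.T x := by
  induction L generalizing x with
  | nil => exact (A.paths hC hd).le_exitCount hx hxd
  | cons a L ih =>
    unfold convoySize
    split_ifs with hxa
    · obtain ⟨m, hm⟩ := hL.2.2
      obtain ⟨S, h1, h2, h3⟩ := (A.paths hC hd).exists_demand_le hx hxd hL.1.le
        (fun y hxy hyd => ih hL.1 (hx.trans hxy) hyd) m
      have h4 := A.budget hC hd hx h1
      have h5 := hm x hx hxa
      have h6 : (S.card : ℝ) ≤ m := by rw [h2]; exact Nat.cast_le.2 (min_le_left _ _)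
      have hBC : 0 < B * C := by positivity
      have h7 : ((n₁ + n₂ + L.length : ℕ) : ℝ) * (B * C) < exitCount A.path A.T x * (B * C) := by
        linarith
      exact Nat.cast_lt.1 (lt_of_mul_lt_mul_right h7 hBC.le)
    · exact ih hL.1 hx hxd

/-- The demand is a lower bound for normal algorithms. -/
lemma le_fuel (hB : 0 < B) (hC : 0 < C) (hd : 0 < d) (hpos : ∀ p, w p ≠ 0 → 0 < p ∧ p ≤ d)
    {L : List ℝ} (hL : Certified B C d n₁ n₂ m₁ w L) (m : ℕ) :
    demand d (n₁ + n₂) (fun k => slope n₁ n₂ m₁ m k) L 0 + (w.sum fun _ q => q) ≤ A.fuel := by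
  obtain ⟨S, h1, _, h3⟩ := (A.paths hC hd).exists_demand_le le_rfl hd hL.le
    (fun y hy hyd => A.convoySize_le_exitCount hB hC hd hL hy hyd) m
  have h2 := A.drawn_eq le_rfl
  have h4 := A.weightBeyond_le (x := 0) hC hd
  have h5 : (w.sum fun _ q => q) = weightBeyond w 0 := by
    rw [weightBeyond, Finset.filter_true_of_mem fun p hp =>
      (hpos p (Finsupp.mem_support_iff.1 hp)).1]
    rfl
  have h6 : ∑ k, canBeyond 0 (A.state A.T) k ≤ ∑ k, (A.state A.T).canFuel k := by
    refine Finset.sum_le_sum fun k _ => ?_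
    unfold canBeyond
    split_ifs
    · exact le_rfl
    · exact ((A.proper hC hd le_rfl).can_mem k).1
  have h7 : 0 ≤ ∑ j, (A.state A.T).tank j :=
    Finset.sum_nonneg fun j _ => ((A.proper hC hd le_rfl).tank_mem j).1
  have h8 : ∑ e ∈ S, excursionLength (A.path e.1) 0 A.T e.2 ≤
      ∑ j, ∑ s ∈ Finset.range A.T, |A.path j (s + 1) - A.path j s| := by
    have h9 : ∑ e ∈ S, excursionLength (A.path e.1) 0 A.T e.2 ≤
        ∑ e ∈ excursions A.path A.T 0, excursionLength (A.path e.1) 0 A.T e.2 :=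
      Finset.sum_le_sum_of_subset_of_nonneg h1 fun e _ _ => excursionLength_nonneg
    have h10 : ∑ e ∈ excursions A.path A.T 0, excursionLength (A.path e.1) 0 A.T e.2 =
        ∑ j, ∑ i ∈ Finset.range (exits (A.path j) 0 A.T), excursionLength (A.path j) 0 A.T i := by
      rw [excursions, Finset.sum_sigma]
    rw [h10] at h9
    refine h9.trans (Finset.sum_le_sum fun j _ => ?_)
    exact sum_excursionLength_le_length (p := A.path j) (x := 0) (T := A.T) _
  rw [fuel]
  linarith

end NormalAlgorithm

end Dewdney

theorem mainTheorem2 (B : ℕ) (hB : 0 < B) (C d : ℝ) (hC : 0 < C) (hd : 0 < d)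
    (n₁ n₂ m₁ : ℕ) (w : ℝ →₀ ℝ) (hw : ∀ p, 0 ≤ w p)
    (hpos : ∀ p, w p ≠ 0 → 0 < p ∧ p ≤ d) :
    (∃ r, Dewdney.AlgorithmResult B C d n₁ n₂ m₁ w r) ∧
    ∀ r, Dewdney.AlgorithmResult B C d n₁ n₂ m₁ w r →
      (∀ (N : ℕ) (A : Dewdney.NormalAlgorithm B C d n₁ n₂ m₁ w N), r ≤ A.fuel) ∧
      (∀ r', Dewdney.ExtendedResult B C d n₁ n₂ m₁ w r' → r ≤ r') := by
  refine ⟨Dewdney.exists_algorithmResult hB hC hd hw hpos, fun r hr => ?_⟩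
  obtain ⟨L, hL, hle⟩ := hr.exists_certified hC hw
  refine ⟨fun N A => (hle _ le_rfl).trans (A.le_fuel hB hC hd hpos hL _), fun r' hr' => ?_⟩
  obtain ⟨k, hk⟩ := hr'.le hB hC hd hw hpos hL
  exact (hle _ (le_max_left _ k)).trans (hk _ (le_max_right _ _))
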